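/- **Theorem (DRM-OffP-LR).** Let $\mathscr S,\mathscr A$ be finite, and consider an episodic MDP with transition probabilities $p(s'\mid s,a)$, reward $r:\mathscr S\times\mathscr A\times\mathscr S\to[-r_{\max},r_{\max}]$, $r_{\max}>0$, discount factor $\gamma\in(0,1)$, fixed initial state $S_0$ and absorbing terminal state $0\in\mathscr S$. For a stationary stochastic policy let $T=\min\{t: S_t=0\}$ be the episode length, where $A_t$ is drawn from the policy at $S_t$ and $S_{t+1}\sim p(\cdot\mid S_t,A_t)$. Let $R^\theta=\sum_{t=0}^{T-1}\gamma^t r(S_t,A_t,S_{t+1})$ be the return of an episode under the policy $\pi_\theta$, $\theta\in\mathbb R^d$, let $F_{R^\theta}$ be its CDF, and write $R^b$ for the return of an episode under a behaviour policy $b$. Put $M_r=r_{\max}/(1-\gamma)$. Let $g:[0,1]\to[0,1]$ be continuous and non-decreasing with $g(0)=0$, $g(1)=1$, and let $$\rho_g(\theta)=\int_{-M_r}^0\big(g(1-F_{R^\theta}(x))-1\big)\,dx+\int_0^{M_r}g(1-F_{R^\theta}(x))\,dx .$$ Assume: 1. (Proper policies) there is an integer $K>0$ with $\max_s\mathbb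 P(S_K\ne0\mid S_0=s,\pi_\theta)<1$ for all $\theta$, and there is an integer $K'>0$ with $\max_s\mathbb P(S_{K'}\ne0\mid S_0=s,b)<1$. 2. For all $s,a$: $\pi_\theta(a\mid s)>0$ for all $\theta$, the function $\theta\mapsto\log\pi_\theta(a\mid s)$ is twice differentiable, and $\|\nabla\log\pi_\theta(a\mid s)\|\le M_d$ (Euclidean norm) and $\|\nabla^2\log\pi_\theta(a\mid s)\|\le M_h$ (operator norm) for all $\theta$. 3. $g$ is twice differentiable on $(0,1)$ with $|g'|\le M_{g'}$ and $|g''|\le M_{g''}$ there. At the end points, $g'(0)$ and $g'(1)$ denote the one-sided derivatives (which then exist). 4. (Absolute continuity) $b(a\mid s)=0$ implies $\pi_\theta(a\mid s)=0$, for all $\theta,a,s$. 5. For episodes generated by $b$ from $S_0$, $T\le M_e$ almost surely, and for every $\theta$ the importance sampling ratio $\psi^\theta=\prod_{t=0}^{T-1}\frac{\pi_\theta(A_t\mid S_t)}{b(A_t\mid S_t)}$ satisfies $\psi^\theta\le M_s$ almost surely. From $m\ge1$ episodes generated by $b$, with returns $R^b_i$, ratios $\psi^\theta_i$, lengths $T^i$,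 states $S^i_t$ and actions $A^i_t$, form $$H^m(x)=\min\Big\{\tfrac1m\sum_{i=1}^m\mathbf 1\{R^b_i\le x\}\psi_i^\theta,\,1\Big\},\qquad \widehat\nabla H^m(x)=\tfrac1m\sum_{i=1}^m\mathbf 1\{R^b_i\le x\}\,\psi_i^\theta\sum_{t=0}^{T^i-1}\nabla\log\pi_\theta(A^i_t\mid S^i_t),$$ $$\widehat\nabla^H\rho_g(\theta)=-\int_{-M_r}^{M_r}g'(1-H^m(x))\,\widehat\nabla H^m(x)\,dx .$$ Let $\alpha>0$, $N\ge1$, let $\theta_0\in\mathbb R^d$ be arbitrary, and let $\theta_{k+1}=\theta_k+\alpha\widehat\nabla^H\rho_g(\theta_k)$ for $k=0,\dots,N-1$, where each iteration uses a fresh batch of $m$ episodes generated by $b$ and all $Nm$ episodes are independent. Let $R$ be uniform on $\{1,\dots,N\}$ and independent of the episodes. Then $\rho_g$ is differentiable, $\rho_g^*=\sup_\theta\rho_g(\theta)$ is finite, $\|\nabla\rho_g(\theta_R)\|^2$ is integrable, and $$\mathbb E\|\nabla\rho_g(\theta_R)\|^2\le\frac{2(\rho_g^*-\rho_g(\theta_0))}{N\alpha}+4M_r^2M_s^2M_e^2M_d^2\left(\alpha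 M_{g'}^2L_{\rho'}+\frac{8\,(e^2M_{g'}^2+M_{g''}^2M_s^2)}{m}\right),$$ where $L_{\rho'}=2M_rM_e\big(M_hM_{g'}+M_eM_d^2(M_{g'}+M_{g''})\big)$. -/

import Mathlib

open MeasureTheory ProbabilityTheory

noncomputable section

/-- A finite episodic Markov decision process: transition law `p(· | s, a)`, bounded reward
`r(s, a, s')`, discount factor in `(0, 1)`, fixed initial state, absorbing terminal state. -/
structure EpisodicMDP (S A : Type*) where
  trans : S → A → PMF S
  reward : S → A → S → ℝ
  rMax : ℝ
  rMax_pos : 0 < rMax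
  abs_reward_le : ∀ s a s', |reward s a s'| ≤ rMax
  discount : ℝ
  discount_pos : 0 < discount
  discount_lt_one : discount < 1
  init : S
  terminal : S
  absorbing : ∀ a, trans terminal a = PMF.pure terminal

/-- A stationary stochastic policy; `π s a` is the probability of action `a` in state `s`. -/
abbrev StochPolicy (S A : Type*) := S → PMF A

/-- A trajectory `(S₀, A₀), (S₁, A₁), …`. -/
abbrev Trajectory (S A : Type*) := ℕ → S × A

namespace EpisodicMDP

variable {S A : Type*}

section Law

variable [Finite S] [Finite A] [MeasurableSpace S] [MeasurableSingletonClass S]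
  [MeasurableSpace A] [MeasurableSingletonClass A]

/-- The law of `(s, A)` with `A ∼ π(· | s)`. -/
def actPMF (π : StochPolicy S A) (s : S) : PMF (S × A) := (π s).map (Prod.mk s)

/-- One step `(s, a) ↦ (s', a')` with `s' ∼ p(· | s, a)` and `a' ∼ π(· | s')`. -/
def stepKernel (M : EpisodicMDP S A) (π : StochPolicy S A) : Kernel (S × A) (S × A) where
  toFun x := ((M.trans x.1 x.2).bind (actPMF π)).toMeasure
  measurable' := Measurable.of_discrete

instance (M : EpisodicMDP S A) (π : StochPolicy S A) : IsMarkovKernel (M.stepKernel π) :=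
  ⟨fun x => inferInstanceAs
    (IsProbabilityMeasure ((M.trans x.1 x.2).bind (actPMF π)).toMeasure)⟩

/-- The law of the whole trajectory under the policy `π` when `S₀ = s`. -/
def law (M : EpisodicMDP S A) (π : StochPolicy S A) (s : S) : Measure (Trajectory S A) :=
  Kernel.trajMeasure (X := fun _ => S × A) (actPMF π s).toMeasure
    (fun n => (M.stepKernel π).comap
      (fun h : (i : Finset.Iic n) → S × A => h ⟨n, Finset.mem_Iic.2 le_rfl⟩)
      (measurable_pi_apply _))

end Law

/-- The trajectory reaches the terminal state. -/
def Terminates (M : EpisodicMDP S A) (τ : Trajectory S A) : Prop :=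
  ∃ t, (τ t).1 = M.terminal

/-- The episode length `T`: the first time at which the terminal state is reached. (It is used
only where the episode terminates almost surely.) -/
def len (M : EpisodicMDP S A) (τ : Trajectory S A) : ℕ := sInf {t | (τ t).1 = M.terminal}

/-- The cumulative discounted reward `∑_{t < T} γ^t r(S_t, A_t, S_{t+1})` of an episode. -/
def ret (M : EpisodicMDP S A) (τ : Trajectory S A) : ℝ :=
  ∑ t ∈ Finset.range (M.len τ),
    M.discount ^ t * M.reward (τ t).1 (τ t).2 (τ (t + 1)).1

/-- `M_r = r_max / (1 - γ)`. -/
def retBound (M : EpisodicMDP S A) : ℝ := M.rMax / (1 - M.discount)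

/-- The importance sampling ratio `∏_{t < T} π(A_t | S_t) / b(A_t | S_t)` of an episode. -/
def isRatio (M : EpisodicMDP S A) (π b : StochPolicy S A) (τ : Trajectory S A) : ℝ :=
  ∏ t ∈ Finset.range (M.len τ),
    (π (τ t).1 (τ t).2).toReal / (b (τ t).1 (τ t).2).toReal

section Law

variable [Finite S] [Finite A] [MeasurableSpace S] [MeasurableSingletonClass S]
  [MeasurableSpace A] [MeasurableSingletonClass A]

/-- The CDF of the cumulative discounted reward of an episode generated by `π`. -/
def retCDF (M : EpisodicMDP S A) (π : StochPolicy S A) (x : ℝ) : ℝ :=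
  (M.law π M.init).real {τ | M.ret τ ≤ x}

/-- The distortion risk measure of the cumulative discounted reward under `π`. -/
def drm (M : EpisodicMDP S A) (g : ℝ → ℝ) (π : StochPolicy S A) : ℝ :=
  (∫ x in (-M.retBound)..0, (g (1 - M.retCDF π x) - 1)) +
    ∫ x in 0..M.retBound, g (1 - M.retCDF π x)

end Law

section Estimate

variable {d m : ℕ}

/-- `∑_{t < T} ∇_θ log π_θ(A_t | S_t)` along an episode. -/
def score (M : EpisodicMDP S A) (π : EuclideanSpace ℝ (Fin d) → StochPolicy S A)
    (θ : EuclideanSpace ℝ (Fin d)) (τ : Trajectory S A) : EuclideanSpace ℝ (Fin d) :=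
  ∑ t ∈ Finset.range (M.len τ),
    gradient (fun η => Real.log (π η (τ t).1 (τ t).2).toReal) θ

/-- The importance-sampling estimate of the CDF of the cumulative reward under `π`, from `m`
episodes `τ` generated by `b`, clipped at `1`. -/
def cdfEst (M : EpisodicMDP S A) (π b : StochPolicy S A) (τ : Fin m → Trajectory S A)
    (x : ℝ) : ℝ :=
  min ((m : ℝ)⁻¹ * ∑ i, {σ | M.ret σ ≤ x}.indicator (M.isRatio π b) (τ i)) 1

/-- The importance-sampling estimate of the gradient of the CDF. -/
def gradCdfEst (M : EpisodicMDP S A) (π : EuclideanSpace ℝ (Fin d) → StochPolicy S A)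
    (b : StochPolicy S A) (θ : EuclideanSpace ℝ (Fin d)) (τ : Fin m → Trajectory S A)
    (x : ℝ) : EuclideanSpace ℝ (Fin d) :=
  (m : ℝ)⁻¹ • ∑ i, {σ | M.ret σ ≤ x}.indicator
    (fun σ => M.isRatio (π θ) b σ • M.score π θ σ) (τ i)

/-- The off-policy estimate of the gradient of the distortion risk measure. Here `g'` is the
derivative of `g` on `[0, 1]`, one-sided at the end points. -/
def drmGradEst (M : EpisodicMDP S A) (g : ℝ → ℝ)
    (π : EuclideanSpace ℝ (Fin d) → StochPolicy S A) (b : StochPolicy S A)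
    (θ : EuclideanSpace ℝ (Fin d)) (τ : Fin m → Trajectory S A) : EuclideanSpace ℝ (Fin d) :=
  -∫ x in (-M.retBound)..M.retBound,
    derivWithin g (Set.Icc 0 1) (1 - M.cdfEst (π θ) b τ x) • M.gradCdfEst π b θ τ x

/-- The iterates of DRM-OffP-LR with step size `α`, started at `θ₀`; iteration `k` uses the batch
`τ k` of `m` episodes generated by `b`. -/
def offPolicyIter (M : EpisodicMDP S A) (g : ℝ → ℝ)
    (π : EuclideanSpace ℝ (Fin d) → StochPolicy S A) (b : StochPolicy S A) (α : ℝ)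
    (θ₀ : EuclideanSpace ℝ (Fin d)) (τ : ℕ → Fin m → Trajectory S A) :
    ℕ → EuclideanSpace ℝ (Fin d)
  | 0 => θ₀
  | k + 1 =>
    offPolicyIter M g π b α θ₀ τ k +
      α • M.drmGradEst g π b (offPolicyIter M g π b α θ₀ τ k) (τ k)

end Estimate

end EpisodicMDP

/-- A distortion function: a continuous non-decreasing `g : [0, 1] → [0, 1]` with `g 0 = 0` and
`g 1 = 1`. -/
structure IsDistortion (g : ℝ → ℝ) : Prop where
  mapsTo : Set.MapsTo g (Set.Icc 0 1) (Set.Icc 0 1)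
  monotoneOn : MonotoneOn g (Set.Icc 0 1)
  map_zero : g 0 = 0
  map_one : g 1 = 1
  continuousOn : ContinuousOn g (Set.Icc 0 1)

/-- The constant `L_{ρ'} = 2 M_r M_e (M_h M_{g'} + M_e M_d² (M_{g'} + M_{g''}))`. -/
def drmLipConst (Mr Me Md Mh Mg' Mg'' : ℝ) : ℝ :=
  2 * Mr * Me * (Mh * Mg' + Me * Md ^ 2 * (Mg' + Mg''))

end

/-!
Episodes generated by `b` have bounded length, so they only involve finitely many prefixes and
every integral over episodes is a finite sum. Changing the measure from `π_θ` to `b` writes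
`F_{R^θ}(x)` as the mean of `1{R^b ≤ x} ψ^θ`, whose gradient carries the extra factor
`∑ ∇ log π_θ`, the score. A bounded score with a bounded derivative makes `ρ_g` differentiable with
a Lipschitz gradient, and since `g'` is Lipschitz on `[0, 1]` the plug-in estimator has mean-square
error `O(1/m)`, uniformly in `θ`. The descent lemma for `-ρ_g`, telescoped over the iterations,
then bounds the averaged squared gradient, provided that `α` times the Lipschitz constant is at
most `1`. For larger steps the trivial bound on the gradient is already enough.
-/

noncomputable section

/-! ### Episodes of bounded length -/

open Classical in
lemma ae_iff_integral_ite_eq_zero {α : Type*} [MeasurableSpace α] {μ : Measure α}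
    [IsFiniteMeasure μ] {p : α → Prop} (hp : Measurable p) :
    (∀ᵐ a ∂μ, p a) ↔ ∫ a, (if p a then 0 else 1 : ℝ) ∂μ = 0 := by
  have hind : (fun a => if p a then 0 else 1 : α → ℝ) = {a | p a}ᶜ.indicator 1 := by
    ext a
    by_cases h : p a <;> simp [h]
  rw [hind, integral_indicator_one (measurableSet_setOfPred.2 hp).compl, measureReal_eq_zero_iff]
  rfl

namespace EpisodicMDP

variable {S A : Type*}

/-- The trajectory that follows `e` up to time `n` and repeats `e n` from then on. A function of
the first `n + 1` steps of an episode thereby becomes a function on a finite type. -/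
def freeze {n : ℕ} (e : Finset.Iic n → S × A) : Trajectory S A :=
  fun t => e ⟨min t n, Finset.mem_Iic.2 (min_le_right t n)⟩

/-- The trajectory `τ` frozen at time `n`. -/
abbrev frozen (n : ℕ) (τ : Trajectory S A) : Trajectory S A :=
  freeze (Preorder.frestrictLe (π := fun _ => S × A) n τ)

lemma frozen_apply {n t : ℕ} (ht : t ≤ n) (τ : Trajectory S A) : frozen n τ t = τ t := by
  simp [freeze, ht]

lemma apply_frozen_of_dependsOn {β : Type*} {n : ℕ} {f : Trajectory S A → β}
    (hf : DependsOn f (Set.Iic n)) (τ : Trajectory S A) : f (frozen n τ) = f τ :=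
  hf fun _ ht => frozen_apply ht τ

lemma dependsOn_comp_frozen {β : Type*} (f : Trajectory S A → β) (n : ℕ) :
    DependsOn (fun τ => f (frozen n τ)) (Set.Iic n) := fun _ _ h =>
  congrArg f (funext fun _ => h _ (Set.mem_Iic.2 (min_le_right _ _)))

lemma apply_update_frozen {β : Type*} {n : ℕ} {f : Trajectory S A → β}
    (hf : DependsOn f (Set.Iic (n + 1))) (τ : Trajectory S A) (x : S × A) :
    f (Function.update (frozen n τ) (n + 1) x) = f (Function.update τ (n + 1) x) := by
  refine hf fun t ht => ?_
  rcases (Set.mem_Iic.1 ht).eq_or_lt with rfl | hlt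
  · simp
  · simp [hlt.ne, frozen_apply (Nat.lt_succ_iff.1 hlt)]

variable {n : ℕ} {τ : Trajectory S A}

/-- The trajectory reaches the terminal state within `n` steps. -/
def TerminatesBy (M : EpisodicMDP S A) (n : ℕ) (τ : Trajectory S A) : Prop :=
  ∃ t ≤ n, (τ t).1 = M.terminal

section Pathwise

variable (M : EpisodicMDP S A)

lemma fst_ne_terminal_of_lt_len {t : ℕ} (ht : t < M.len τ) : (τ t).1 ≠ M.terminal :=
  Nat.notMem_of_lt_sInf ht

lemma fst_len (h : M.Terminates τ) : (τ (M.len τ)).1 = M.terminal :=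
  Nat.sInf_mem (s := {t | (τ t).1 = M.terminal}) h

lemma len_le_of_fst_eq {t : ℕ} (ht : (τ t).1 = M.terminal) : M.len τ ≤ t :=
  Nat.sInf_le ht

lemma terminatesBy_iff : M.TerminatesBy n τ ↔ M.Terminates τ ∧ M.len τ ≤ n :=
  ⟨fun ⟨t, htn, ht⟩ => ⟨⟨t, ht⟩, (M.len_le_of_fst_eq ht).trans htn⟩,
    fun ⟨h, hle⟩ => ⟨_, hle, M.fst_len h⟩⟩

lemma terminatesBy_frozen_iff : M.TerminatesBy n (frozen n τ) ↔ M.TerminatesBy n τ :=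
  exists_congr fun _ => and_congr_right fun ht => by rw [frozen_apply ht]

lemma len_frozen (h : M.TerminatesBy n τ) : M.len (frozen n τ) = M.len τ := by
  obtain ⟨hterm, hlen⟩ := M.terminatesBy_iff.1 h
  obtain ⟨hterm', hlen'⟩ := M.terminatesBy_iff.1 (M.terminatesBy_frozen_iff.2 h)
  refine le_antisymm (M.len_le_of_fst_eq ?_) (M.len_le_of_fst_eq ?_)
  · rw [frozen_apply hlen, M.fst_len hterm]
  · rw [← frozen_apply hlen' τ, M.fst_len hterm']

lemma frozen_apply_of_le_len (h : M.TerminatesBy n τ) {t : ℕ} (ht : t ≤ M.len τ) :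
    frozen n τ t = τ t :=
  frozen_apply (ht.trans (M.terminatesBy_iff.1 h).2) τ

lemma ret_frozen (h : M.TerminatesBy n τ) : M.ret (frozen n τ) = M.ret τ := by
  rw [ret, ret, M.len_frozen h]
  refine Finset.sum_congr rfl fun t ht => ?_
  have hlt := Finset.mem_range.1 ht
  rw [M.frozen_apply_of_le_len h hlt.le, M.frozen_apply_of_le_len h hlt]

lemma isRatio_frozen (π b : StochPolicy S A) (h : M.TerminatesBy n τ) :
    M.isRatio π b (frozen n τ) = M.isRatio π b τ := by
  rw [isRatio, isRatio, M.len_frozen h]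
  refine Finset.prod_congr rfl fun t ht => ?_
  rw [M.frozen_apply_of_le_len h (Finset.mem_range.1 ht).le]

lemma score_frozen {d : ℕ} (π : EuclideanSpace ℝ (Fin d) → StochPolicy S A)
    (θ : EuclideanSpace ℝ (Fin d)) (h : M.TerminatesBy n τ) :
    M.score π θ (frozen n τ) = M.score π θ τ := by
  rw [score, score, M.len_frozen h]
  refine Finset.sum_congr rfl fun t ht => ?_
  rw [M.frozen_apply_of_le_len h (Finset.mem_range.1 ht).le]

/-- The likelihood ratio of a state-action pair, set to `1` in the terminal state, where actions
have no effect: its product along an episode then stops at the episode length. -/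
def stepRatio (M : EpisodicMDP S A) (π b : StochPolicy S A) (x : S × A) : ℝ :=
  open Classical in
  if x.1 = M.terminal then 1 else (π x.1 x.2).toReal / (b x.1 x.2).toReal

/-- A function of the trajectory that does not depend on the actions in the terminal state. -/
def IgnoresTerminal (M : EpisodicMDP S A) {β : Type*} (f : Trajectory S A → β) : Prop :=
  ∀ τ τ' : Trajectory S A, (∀ t, (τ t).1 = (τ' t).1) →
    (∀ t, (τ t).1 ≠ M.terminal → (τ t).2 = (τ' t).2) → f τ = f τ'

lemma ignoresTerminal_ret : M.IgnoresTerminal M.ret := by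
  intro τ τ' hstate haction
  have hlen : M.len τ = M.len τ' := by simp only [len, hstate]
  rw [ret, ret, ← hlen]
  refine Finset.sum_congr rfl fun t ht => ?_
  rw [haction t (M.fst_ne_terminal_of_lt_len (Finset.mem_range.1 ht)), hstate, hstate]

lemma ignoresTerminal_terminatesBy (n : ℕ) : M.IgnoresTerminal (M.TerminatesBy n) :=
  fun τ τ' hstate _ => by simp only [TerminatesBy, hstate]

lemma IgnoresTerminal.apply_update_eq {M : EpisodicMDP S A} {β : Type*}
    {f : Trajectory S A → β} (hf : M.IgnoresTerminal f) (τ : Trajectory S A) (n : ℕ) (a a' : A) :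
    f (Function.update τ n (M.terminal, a)) = f (Function.update τ n (M.terminal, a')) := by
  refine hf _ _ (fun t => ?_) fun t => ?_ <;> rcases eq_or_ne t n with rfl | ht <;> simp [*]

lemma IgnoresTerminal.comp_frozen {M : EpisodicMDP S A} {β : Type*} {f : Trajectory S A → β}
    (hf : M.IgnoresTerminal f) (n : ℕ) : M.IgnoresTerminal fun τ => f (frozen n τ) :=
  fun _ _ hstate haction => hf _ _ (fun _ => hstate _) fun _ => haction _

lemma dependsOn_prod_stepRatio (π b : StochPolicy S A) (n : ℕ) :
    DependsOn (fun τ => ∏ t ∈ Finset.range (n + 1), M.stepRatio π b (τ t)) (Set.Iic n) :=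
  fun _ _ h => Finset.prod_congr rfl fun t ht => by
    rw [h t (Set.mem_Iic.2 (Finset.mem_range_succ_iff.1 ht))]

lemma prod_stepRatio_update (π b : StochPolicy S A) (n : ℕ)
    (τ : Trajectory S A) (x : S × A) :
    ∏ t ∈ Finset.range (n + 1 + 1), M.stepRatio π b (Function.update τ (n + 1) x t) =
      (∏ t ∈ Finset.range (n + 1), M.stepRatio π b (τ t)) * M.stepRatio π b x := by
  rw [Finset.prod_range_succ, Function.update_self]
  congr 1
  refine Finset.prod_congr rfl fun t ht => ?_
  rw [Function.update_of_ne (Finset.mem_range.1 ht).ne]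

lemma prod_stepRatio_eq_isRatio (π b : StochPolicy S A) (h : M.TerminatesBy n τ)
    (habsorb : ∀ t, (τ t).1 = M.terminal → (τ (t + 1)).1 = M.terminal) :
    ∏ t ∈ Finset.range (n + 1), M.stepRatio π b (τ t) = M.isRatio π b τ := by
  obtain ⟨hterm, hlen⟩ := M.terminatesBy_iff.1 h
  have hstay : ∀ t, M.len τ ≤ t → (τ t).1 = M.terminal :=
    Nat.le_induction (M.fst_len hterm) fun t _ => habsorb t
  rw [isRatio, ← Finset.prod_subset (s₁ := Finset.range (M.len τ))]
  · refine Finset.prod_congr rfl fun t ht => ?_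
    simp [stepRatio, M.fst_ne_terminal_of_lt_len (Finset.mem_range.1 ht)]
  · exact Finset.range_mono (by lia)
  · intro t _ ht
    simp [stepRatio, hstay t (by simpa using ht)]

end Pathwise

section Law

variable [Finite S] [Finite A] [MeasurableSpace S] [MeasurableSingletonClass S]
  [MeasurableSpace A] [MeasurableSingletonClass A]

instance (M : EpisodicMDP S A) (π : StochPolicy S A) (s : S) :
    IsProbabilityMeasure (M.law π s) := by
  unfold law; infer_instance

lemma measurable_of_dependsOn {β : Type*} [MeasurableSpace β] {n : ℕ} {f : Trajectory S A → β}
    (hf : DependsOn f (Set.Iic n)) : Measurable f := by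
  have hfactor : f = (fun e => f (freeze e)) ∘ Preorder.frestrictLe (π := fun _ => S × A) n :=
    funext fun τ => (apply_frozen_of_dependsOn hf τ).symm
  rw [hfactor]
  exact Measurable.of_discrete.comp (Preorder.measurable_frestrictLe n)

lemma integral_actPMF (π : StochPolicy S A) (s : S) (F : S × A → ℝ) :
    ∫ x, F x ∂(actPMF π s).toMeasure = ∫ a, F (s, a) ∂(π s).toMeasure := by
  rw [actPMF, ← PMF.toMeasure_map _ _ (Measurable.of_discrete (f := Prod.mk s)),
    integral_map Measurable.of_discrete.aemeasurable Measurable.of_discrete.aestronglyMeasurable]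

lemma integral_stepKernel (M : EpisodicMDP S A) (π : StochPolicy S A) (y : S × A)
    (F : S × A → ℝ) :
    ∫ x, F x ∂M.stepKernel π y =
      ∫ s, ∫ x, F x ∂(actPMF π s).toMeasure ∂(M.trans y.1 y.2).toMeasure := by
  have := Fintype.ofFinite S
  have := Fintype.ofFinite A
  change ∫ x, F x ∂((M.trans y.1 y.2).bind (actPMF π)).toMeasure = _
  simp only [PMF.integral_eq_sum, PMF.bind_apply, tsum_fintype, smul_eq_mul, Finset.mul_sum]
  rw [Finset.sum_comm]
  refine Finset.sum_congr rfl fun x _ => ?_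
  rw [ENNReal.toReal_sum fun s _ => ENNReal.mul_ne_top (PMF.apply_ne_top _ _)
    (PMF.apply_ne_top _ _), Finset.sum_mul]
  exact Finset.sum_congr rfl fun s _ => by rw [ENNReal.toReal_mul, mul_assoc]

lemma map_frestrictLe_zero_law (M : EpisodicMDP S A) (π : StochPolicy S A) (s : S) :
    (M.law π s).map (Preorder.frestrictLe (π := fun _ => S × A) 0) =
      (actPMF π s).toMeasure.map
        (MeasurableEquiv.piUnique (fun _ : Finset.Iic 0 => S × A)).symm := by
  rw [law, Kernel.trajMeasure, Measure.map_comp _ _ (Preorder.measurable_frestrictLe 0),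
    Kernel.traj_map_frestrictLe_of_le le_rfl, Measure.deterministic_comp_eq_map]
  exact Measure.map_id

lemma integral_law_zero (M : EpisodicMDP S A) (π : StochPolicy S A) (s : S)
    {f : Trajectory S A → ℝ} (hf : DependsOn f (Set.Iic 0)) :
    ∫ τ, f τ ∂M.law π s = ∫ x, f (fun _ => x) ∂(actPMF π s).toMeasure := by
  calc ∫ τ, f τ ∂M.law π s
      = ∫ e, f (freeze e) ∂(M.law π s).map (Preorder.frestrictLe (π := fun _ => S × A) 0) := by
        rw [integral_map (Preorder.measurable_frestrictLe 0).aemeasurable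
          Measurable.of_discrete.aestronglyMeasurable]
        simp_rw [apply_frozen_of_dependsOn hf]
    _ = ∫ x, f (fun _ => x) ∂(actPMF π s).toMeasure := by
        rw [map_frestrictLe_zero_law, integral_map (by fun_prop)
          Measurable.of_discrete.aestronglyMeasurable]
        rfl

lemma integral_law_succ (M : EpisodicMDP S A) (π : StochPolicy S A) (s : S) {n : ℕ}
    {f : Trajectory S A → ℝ} (hf : DependsOn f (Set.Iic (n + 1))) :
    ∫ τ, f τ ∂M.law π s =
      ∫ τ, ∫ x, f (Function.update τ (n + 1) x) ∂M.stepKernel π (τ n) ∂M.law π s := by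
  let κ := (M.stepKernel π).comap
    (fun h : (i : Finset.Iic n) → S × A => h ⟨n, Finset.mem_Iic.2 le_rfl⟩) (measurable_pi_apply _)
  have hlaw : ((M.law π s).map (Preorder.frestrictLe (π := fun _ => S × A) n)) ⊗ₘ κ =
      (M.law π s).map fun τ => (Preorder.frestrictLe (π := fun _ => S × A) n τ, τ (n + 1)) :=
    Kernel.map_frestrictLe_trajMeasure_compProd_eq_map_trajMeasure (X := fun _ => S × A)
  calc ∫ τ, f τ ∂M.law π s
      = ∫ p, f (Function.update (freeze p.1) (n + 1) p.2) ∂(M.law π s).map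
          fun τ => (Preorder.frestrictLe (π := fun _ => S × A) n τ, τ (n + 1)) := by
        rw [integral_map (by fun_prop) Measurable.of_discrete.aestronglyMeasurable]
        simp only [apply_update_frozen hf, Function.update_eq_self]
    _ = _ := by
        rw [← hlaw, Measure.integral_compProd .of_finite, integral_map
          (Preorder.measurable_frestrictLe n).aemeasurable
          Measurable.of_discrete.aestronglyMeasurable]
        simp only [apply_update_frozen hf]
        rfl

lemma integral_actPMF_eq_integral_mul_stepRatio (M : EpisodicMDP S A) {π b : StochPolicy S A}
    (hac : ∀ s a, b s a = 0 → π s a = 0) (s : S) {F : S × A → ℝ}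
    (hF : s = M.terminal → ∀ a a', F (s, a) = F (s, a')) :
    ∫ x, F x ∂(actPMF π s).toMeasure =
      ∫ x, F x * M.stepRatio π b x ∂(actPMF b s).toMeasure := by
  simp only [integral_actPMF]
  by_cases hs : s = M.terminal
  · obtain ⟨a₀, -⟩ := (b s).support_nonempty
    simp only [stepRatio, hs, if_true, mul_one]
    simp only [← hs, hF hs _ a₀, integral_const, probReal_univ]
  · have := Fintype.ofFinite A
    simp only [PMF.integral_eq_sum, stepRatio, hs, if_false, smul_eq_mul]
    refine Finset.sum_congr rfl fun a _ => ?_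
    by_cases hb : b s a = 0
    · simp [hb, hac s a hb]
    · have hb' : (b s a).toReal ≠ 0 := ENNReal.toReal_ne_zero.2 ⟨hb, (b s).apply_ne_top a⟩
      field_simp

lemma integral_stepKernel_eq_integral_mul_stepRatio (M : EpisodicMDP S A)
    {π b : StochPolicy S A} (hac : ∀ s a, b s a = 0 → π s a = 0) (y : S × A) {F : S × A → ℝ}
    (hF : ∀ a a', F (M.terminal, a) = F (M.terminal, a')) :
    ∫ x, F x ∂M.stepKernel π y = ∫ x, F x * M.stepRatio π b x ∂M.stepKernel b y := by
  simp only [integral_stepKernel]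
  congr! 2 with s
  exact integral_actPMF_eq_integral_mul_stepRatio M hac s fun hs => hs ▸ hF

lemma integral_update_congr (M : EpisodicMDP S A) (π : StochPolicy S A) {n : ℕ}
    {f : Trajectory S A → ℝ} {τ τ' : Trajectory S A}
    (htrans : M.trans (τ n).1 (τ n).2 = M.trans (τ' n).1 (τ' n).2)
    (hf : ∀ x, f (Function.update τ (n + 1) x) = f (Function.update τ' (n + 1) x)) :
    ∫ x, f (Function.update τ (n + 1) x) ∂M.stepKernel π (τ n) =
      ∫ x, f (Function.update τ' (n + 1) x) ∂M.stepKernel π (τ' n) := by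
  simp only [integral_stepKernel, htrans, hf]

lemma dependsOn_integral_update (M : EpisodicMDP S A) (π : StochPolicy S A) {n : ℕ}
    {f : Trajectory S A → ℝ} (hf : DependsOn f (Set.Iic (n + 1))) :
    DependsOn (fun τ => ∫ x, f (Function.update τ (n + 1) x) ∂M.stepKernel π (τ n))
      (Set.Iic n) := fun τ τ' h =>
  M.integral_update_congr π (by rw [h n (Set.mem_Iic.2 le_rfl)]) fun x => by
    rw [← apply_update_frozen hf τ, ← apply_update_frozen hf τ']
    congr 2
    exact funext fun t => h _ (Set.mem_Iic.2 (min_le_right t n))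

lemma IgnoresTerminal.integral_update {M : EpisodicMDP S A} (π : StochPolicy S A) (n : ℕ)
    {f : Trajectory S A → ℝ} (hf : M.IgnoresTerminal f) :
    M.IgnoresTerminal fun τ =>
      ∫ x, f (Function.update τ (n + 1) x) ∂M.stepKernel π (τ n) := by
  refine fun τ τ' hstate haction => M.integral_update_congr π ?_ fun x => hf _ _ ?_ ?_
  · by_cases hn : (τ n).1 = M.terminal
    · rw [← hstate n, hn, M.absorbing, M.absorbing]
    · rw [← hstate n, ← haction n hn]
  · intro t
    rcases eq_or_ne t (n + 1) with rfl | ht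
    · simp
    · simp [ht, hstate t]
  · intro t
    rcases eq_or_ne t (n + 1) with rfl | ht
    · simp
    · simpa [ht] using haction t

lemma integral_law_eq_integral_mul_prod_stepRatio (M : EpisodicMDP S A) {π b : StochPolicy S A}
    (hac : ∀ s a, b s a = 0 → π s a = 0) (s : S) {n : ℕ} {f : Trajectory S A → ℝ}
    (hdep : DependsOn f (Set.Iic n)) (hign : M.IgnoresTerminal f) :
    ∫ τ, f τ ∂M.law π s =
      ∫ τ, f τ * ∏ t ∈ Finset.range (n + 1), M.stepRatio π b (τ t) ∂M.law b s := by
  have hdep_mul : ∀ {n} {f : Trajectory S A → ℝ}, DependsOn f (Set.Iic n) →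
      DependsOn (fun τ => f τ * ∏ t ∈ Finset.range (n + 1), M.stepRatio π b (τ t))
        (Set.Iic n) := fun hf _ _ h =>
    congrArg₂ _ (hf h) (M.dependsOn_prod_stepRatio π b _ h)
  induction n generalizing f with
  | zero =>
    rw [integral_law_zero M π s hdep, integral_law_zero M b s (hdep_mul hdep)]
    simp only [zero_add, Finset.prod_range_one]
    refine M.integral_actPMF_eq_integral_mul_stepRatio hac s fun hs a a' => ?_
    exact hign _ _ (fun _ => rfl) fun _ ht => absurd hs ht
  | succ n ih =>
    rw [integral_law_succ M π s hdep, integral_law_succ M b s (hdep_mul hdep),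
      ih (M.dependsOn_integral_update π hdep) (hign.integral_update π n)]
    congr! 2 with τ
    rw [M.integral_stepKernel_eq_integral_mul_stepRatio hac (τ n)
      (fun a a' => hign.apply_update_eq τ (n + 1) a a'), ← integral_mul_const]
    simp only [prod_stepRatio_update]
    congr! 2
    ring

lemma ae_absorbing (M : EpisodicMDP S A) (π : StochPolicy S A) (s : S) :
    ∀ᵐ τ ∂M.law π s, ∀ t, (τ t).1 = M.terminal → (τ (t + 1)).1 = M.terminal := by
  rw [ae_all_iff]
  intro n
  let p : Trajectory S A → Prop := fun τ =>
    (τ n).1 = M.terminal → (τ (n + 1)).1 = M.terminal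
  have hp : DependsOn p (Set.Iic (n + 1)) := fun τ τ' h => by
    simp only [p, h n (by simp), h (n + 1) (by simp)]
  refine (ae_iff_integral_ite_eq_zero (measurable_of_dependsOn hp)).2 ?_
  rw [integral_law_succ M π s fun τ τ' h => by rw [hp h]]
  refine integral_eq_zero_of_ae (ae_of_all _ fun τ => ?_)
  by_cases hτ : (τ n).1 = M.terminal
  · dsimp only
    rw [integral_stepKernel, hτ, M.absorbing, PMF.toMeasure_pure, integral_dirac, integral_actPMF]
    simp [p]
  · simp [p, hτ]

variable {M : EpisodicMDP S A} {π b : StochPolicy S A} {s : S}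

/-- The law of the first `n + 1` steps of an episode. -/
def prefixLaw (M : EpisodicMDP S A) (π : StochPolicy S A) (s : S) (n : ℕ) :
    Measure (Finset.Iic n → S × A) :=
  (M.law π s).map (Preorder.frestrictLe (π := fun _ => S × A) n)

instance : IsProbabilityMeasure (M.prefixLaw π s n) :=
  Measure.isProbabilityMeasure_map (Preorder.measurable_frestrictLe n).aemeasurable

lemma integral_prefixLaw (f : Trajectory S A → ℝ) :
    ∫ e, f (freeze e) ∂M.prefixLaw π s n = ∫ τ, f (frozen n τ) ∂M.law π s :=
  integral_map (Preorder.measurable_frestrictLe n).aemeasurable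
    Measurable.of_discrete.aestronglyMeasurable

lemma ae_prefixLaw_iff {p : Trajectory S A → Prop} :
    (∀ᵐ e ∂M.prefixLaw π s n, p (freeze e)) ↔ ∀ᵐ τ ∂M.law π s, p (frozen n τ) :=
  ae_map_iff (Preorder.measurable_frestrictLe n).aemeasurable (Set.toFinite _).measurableSet

lemma integral_frozen_eq_integral_prefixLaw_mul_isRatio (hac : ∀ s a, b s a = 0 → π s a = 0)
    (hterm : ∀ᵐ τ ∂M.law b s, M.TerminatesBy n τ) {f : Trajectory S A → ℝ}
    (hf : M.IgnoresTerminal f) :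
    ∫ τ, f (frozen n τ) ∂M.law π s =
      ∫ e, f (freeze e) * M.isRatio π b (freeze e) ∂M.prefixLaw b s n := by
  rw [integral_law_eq_integral_mul_prod_stepRatio M hac s (dependsOn_comp_frozen f n)
    (hf.comp_frozen n), integral_prefixLaw fun τ => f τ * M.isRatio π b τ]
  refine integral_congr_ae ?_
  filter_upwards [hterm, ae_absorbing M b s] with τ hτ habs
  rw [M.isRatio_frozen π b hτ, M.prod_stepRatio_eq_isRatio π b hτ habs]

lemma integral_prefixLaw_isRatio (hac : ∀ s a, b s a = 0 → π s a = 0)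
    (hterm : ∀ᵐ τ ∂M.law b s, M.TerminatesBy n τ) :
    ∫ e, M.isRatio π b (freeze e) ∂M.prefixLaw b s n = 1 := by
  simpa using (integral_frozen_eq_integral_prefixLaw_mul_isRatio hac hterm
    (f := fun _ => 1) fun _ _ _ _ => rfl).symm

lemma ae_terminatesBy_of_behaviour (hac : ∀ s a, b s a = 0 → π s a = 0)
    (hterm : ∀ᵐ τ ∂M.law b s, M.TerminatesBy n τ) :
    ∀ᵐ τ ∂M.law π s, M.TerminatesBy n τ := by
  classical
  have hfrozen : ∀ᵐ e ∂M.prefixLaw b s n, M.TerminatesBy n (freeze e) :=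
    ae_prefixLaw_iff.2 (hterm.mono fun _ => M.terminatesBy_frozen_iff.2)
  suffices h : ∀ᵐ τ ∂M.law π s, M.TerminatesBy n (frozen n τ) from
    h.mono fun _ => M.terminatesBy_frozen_iff.1
  rw [ae_iff_integral_ite_eq_zero (measurable_of_dependsOn (dependsOn_comp_frozen _ n)),
    integral_frozen_eq_integral_prefixLaw_mul_isRatio hac hterm
      (f := fun τ => if M.TerminatesBy n τ then 0 else 1)
      fun τ τ' h h' => by simp only [M.ignoresTerminal_terminatesBy n τ τ' h h']]
  refine integral_eq_zero_of_ae ?_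
  filter_upwards [hfrozen] with e he
  simp [he]

lemma retCDF_eq_setIntegral_isRatio (hac : ∀ s a, b s a = 0 → π s a = 0)
    (hterm : ∀ᵐ τ ∂M.law b M.init, M.TerminatesBy n τ) (x : ℝ) :
    M.retCDF π x =
      ∫ e in {e | M.ret (freeze e) ≤ x}, M.isRatio π b (freeze e) ∂M.prefixLaw b M.init n := by
  classical
  have hmeas : MeasurableSet {τ : Trajectory S A | M.ret (frozen n τ) ≤ x} :=
    measurableSet_le (measurable_of_dependsOn (dependsOn_comp_frozen M.ret n)) measurable_const
  calc M.retCDF π x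
      = (M.law π M.init).real {τ | M.ret (frozen n τ) ≤ x} := by
        refine measureReal_congr (Filter.eventuallyEq_set.2 ?_)
        filter_upwards [ae_terminatesBy_of_behaviour hac hterm] with τ hτ
        simp only [M.ret_frozen hτ]
    _ = ∫ τ, {τ | M.ret τ ≤ x}.indicator 1 (frozen n τ) ∂M.law π M.init := by
        rw [← integral_indicator_one hmeas]
        rfl
    _ = ∫ e, {τ | M.ret τ ≤ x}.indicator 1 (freeze e) * M.isRatio π b (freeze e)
          ∂M.prefixLaw b M.init n :=
        integral_frozen_eq_integral_prefixLaw_mul_isRatio hac hterm fun τ τ' h h' => by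
          simp only [Set.indicator_apply, Set.mem_ofPred_eq, M.ignoresTerminal_ret τ τ' h h',
            Pi.one_apply]
    _ = _ := by
        rw [← integral_indicator (Set.toFinite _).measurableSet]
        congr! 2 with e
        by_cases he : M.ret (freeze e) ≤ x <;> simp [he]

end Law

end EpisodicMDP

/-! ### Lipschitz derivatives and the ascent inequality -/

section Derivative

open Set Filter Topology

/-- `g` is differentiable on `s` relative to `s`, so with one-sided derivatives at the end points
of an interval, and this derivative is bounded by `C` and Lipschitz with constant `L`. -/
structure HasLipschitzDerivOn (g : ℝ → ℝ) (s : Set ℝ) (C L : ℝ) : Prop where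
  hasDerivWithinAt : ∀ t ∈ s, HasDerivWithinAt g (derivWithin g s t) s t
  abs_derivWithin_le : ∀ t ∈ s, |derivWithin g s t| ≤ C
  abs_derivWithin_sub_le : ∀ t ∈ s, ∀ u ∈ s, |derivWithin g s t - derivWithin g s u| ≤ L * |t - u|

namespace HasLipschitzDerivOn

variable {g : ℝ → ℝ} {s : Set ℝ} {C L : ℝ}

lemma bound_nonneg (hg : HasLipschitzDerivOn g s C L) (hs : s.Nonempty) :
    0 ≤ C :=
  have ⟨_, ht⟩ := hs
  (abs_nonneg _).trans (hg.abs_derivWithin_le _ ht)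

lemma lipschitz_nonneg (hg : HasLipschitzDerivOn g s C L)
    (hs : s.Nontrivial) : 0 ≤ L :=
  have ⟨_, ht, _, hu, htu⟩ := hs
  nonneg_of_mul_nonneg_left ((abs_nonneg _).trans (hg.abs_derivWithin_sub_le _ ht _ hu))
    (abs_pos.2 (sub_ne_zero.2 htu))

lemma norm_smul_sub_smul_le {W : Type*} [NormedAddCommGroup W]
    [NormedSpace ℝ W] (hg : HasLipschitzDerivOn g s C L) {t u : ℝ} (ht : t ∈ s) (hu : u ∈ s)
    (v w : W) :
    ‖derivWithin g s t • v - derivWithin g s u • w‖ ≤ C * ‖v - w‖ + L * |t - u| * ‖w‖ :=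
  calc _ = ‖derivWithin g s t • (v - w) + (derivWithin g s t - derivWithin g s u) • w‖ := by
        rw [smul_sub, sub_smul, sub_add_sub_cancel]
    _ ≤ |derivWithin g s t| * ‖v - w‖ + |derivWithin g s t - derivWithin g s u| * ‖w‖ := by
        refine (norm_add_le _ _).trans_eq ?_
        rw [norm_smul, norm_smul, Real.norm_eq_abs, Real.norm_eq_abs]
    _ ≤ _ := by
        gcongr
        · exact hg.abs_derivWithin_le t ht
        · exact hg.abs_derivWithin_sub_le t ht u hu

lemma bddAbove_image (hg : HasLipschitzDerivOn g s C L) (hs : IsCompact s) :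
    BddAbove (g '' s) :=
  hs.bddAbove_image fun t ht => (hg.hasDerivWithinAt t ht).continuousWithinAt

end HasLipschitzDerivOn

lemma hasDerivWithinAt_Icc_of_continuous_extension {g h : ℝ → ℝ} {a b : ℝ} (hab : a < b)
    (hg : ContinuousOn g (Icc a b)) (hg' : DifferentiableOn ℝ g (Ioo a b)) (hh : Continuous h)
    (heq : EqOn (deriv g) h (Ioo a b)) {t : ℝ} (ht : t ∈ Icc a b) :
    HasDerivWithinAt g (h t) (Icc a b) t := by
  have hg_Ioo := (hg t ht).mono Ioo_subset_Icc_self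
  rcases eq_endpoints_or_mem_Ioo_of_mem_Icc ht with rfl | rfl | ht'
  · refine (hasDerivWithinAt_Ici_of_tendsto_deriv hg' hg_Ioo (Ioo_mem_nhdsGT hab) ?_).mono
      Icc_subset_Ici_self
    refine (hh.continuousWithinAt (s := Ioi t)).tendsto.congr' ?_
    filter_upwards [Ioo_mem_nhdsGT hab] with x hx using (heq hx).symm
  · refine (hasDerivWithinAt_Iic_of_tendsto_deriv hg' hg_Ioo (Ioo_mem_nhdsLT hab) ?_).mono
      Icc_subset_Iic_self
    refine (hh.continuousWithinAt (s := Iio t)).tendsto.congr' ?_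
    filter_upwards [Ioo_mem_nhdsLT hab] with x hx using (heq hx).symm
  · rw [← heq ht']
    exact ((hg' t ht').differentiableAt (isOpen_Ioo.mem_nhds ht')).hasDerivAt.hasDerivWithinAt

lemma hasLipschitzDerivOn_Icc {g : ℝ → ℝ} {a b C L : ℝ} (hab : a < b)
    (hg : ContinuousOn g (Icc a b)) (hg' : DifferentiableOn ℝ g (Ioo a b))
    (hC : ∀ t ∈ Ioo a b, |deriv g t| ≤ C) (hg'' : DifferentiableOn ℝ (deriv g) (Ioo a b))
    (hL : ∀ t ∈ Ioo a b, |deriv (deriv g) t| ≤ L) : HasLipschitzDerivOn g (Icc a b) C L := by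
  have hL0 : 0 ≤ L := (nonempty_Ioo.2 hab).elim fun t ht => (abs_nonneg _).trans (hL t ht)
  have hlip : LipschitzOnWith ⟨L, hL0⟩ (deriv g) (Ioo a b) :=
    (convex_Ioo a b).lipschitzOnWith_of_nnnorm_deriv_le
      (fun t ht => (hg'' t ht).differentiableAt (isOpen_Ioo.mem_nhds ht)) hL
  obtain ⟨h, hh, heq⟩ := hlip.extend_real
  have hderiv : ∀ t ∈ Icc a b, HasDerivWithinAt g (h t) (Icc a b) t := fun t ht =>
    hasDerivWithinAt_Icc_of_continuous_extension hab hg hg' hh.continuous heq ht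
  have hval : ∀ t ∈ Icc a b, derivWithin g (Icc a b) t = h t := fun t ht =>
    (hderiv t ht).derivWithin (uniqueDiffOn_Icc hab t ht)
  refine ⟨fun t ht => hval t ht ▸ hderiv t ht, fun t ht => ?_, fun t ht u hu => ?_⟩
  · rw [hval t ht]
    rw [← closure_Ioo hab.ne] at ht
    exact closure_minimal (fun u hu => by simpa only [mem_ofPred_eq, ← heq hu] using hC u hu)
      (isClosed_le hh.continuous.abs continuous_const) ht
  · rw [hval t ht, hval u hu]
    exact hh.dist_le_mul t u

end Derivative

section Ascent

variable {V : Type*} [NormedAddCommGroup V] [InnerProductSpace ℝ V] [CompleteSpace V]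

lemma hasGradientAt_comp_one_sub {g : ℝ → ℝ} {g' : ℝ} {F : V → ℝ} {F' θ : V} {I : Set ℝ}
    (hg : HasDerivWithinAt g g' I (1 - F θ)) (hF : HasGradientAt F F' θ)
    (hI : ∀ η, 1 - F η ∈ I) : HasGradientAt (fun η => g (1 - F η)) (-(g' • F')) θ := by
  rw [hasGradientAt_iff_hasFDerivAt] at hF ⊢
  refine (hg.comp_hasFDerivAt θ (hF.const_sub 1) (.of_forall hI)).congr_fderiv ?_
  ext v
  simp

lemma hasFDerivAt_integral_of_finite {α E F : Type*} [Finite α] [MeasurableSpace α]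
    [MeasurableSingletonClass α] [NormedAddCommGroup E] [NormedSpace ℝ E] [NormedAddCommGroup F]
    [NormedSpace ℝ F] [CompleteSpace F] (μ : Measure α) [IsFiniteMeasure μ] {f : α → E → F}
    {f' : α → E →L[ℝ] F} {x : E} (h : ∀ a, HasFDerivAt (f a) (f' a) x) :
    HasFDerivAt (fun y => ∫ a, f a y ∂μ) (∫ a, f' a ∂μ) x := by
  have := Fintype.ofFinite α
  simp only [integral_fintype .of_finite]
  exact HasFDerivAt.fun_sum fun a _ => (h a).const_smul (μ.real {a})

lemma hasGradientAt_integral_of_finite {α : Type*} [Finite α] [MeasurableSpace α]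
    [MeasurableSingletonClass α] (μ : Measure α) [IsFiniteMeasure μ] {f : α → V → ℝ} {f' : α → V}
    {θ : V} (h : ∀ a, HasGradientAt (f a) (f' a) θ) :
    HasGradientAt (fun η => ∫ a, f a η ∂μ) (∫ a, f' a ∂μ) θ := by
  rw [hasGradientAt_iff_hasFDerivAt]
  refine (hasFDerivAt_integral_of_finite μ fun a => (h a).hasFDerivAt).congr_fderiv ?_
  exact (InnerProductSpace.toDual ℝ V).toLinearIsometry.toContinuousLinearMap.integral_comp_comm
    .of_finite

lemma norm_sub_le_of_hasGradientAt {f : V → ℝ} {f' : V → V} {C : ℝ}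
    (hf : ∀ θ, HasGradientAt f (f' θ) θ) (hC : ∀ θ, ‖f' θ‖ ≤ C) (θ η : V) :
    |f θ - f η| ≤ C * ‖θ - η‖ :=
  convex_univ.norm_image_sub_le_of_norm_hasFDerivWithin_le
    (fun x _ => (hf x).hasFDerivAt.hasFDerivWithinAt) (fun x _ => by simpa using hC x)
    (Set.mem_univ η) (Set.mem_univ θ)

lemma add_inner_sub_le_of_lipschitz_gradient {f : V → ℝ} {f' : V → V} {L : ℝ}
    (hf : ∀ θ, HasGradientAt f (f' θ) θ) (hL : ∀ θ η, ‖f' θ - f' η‖ ≤ L * ‖θ - η‖) (θ v : V) :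
    f θ + inner ℝ (f' θ) v - L / 2 * ‖v‖ ^ 2 ≤ f (θ + v) := by
  let φ : ℝ → ℝ := fun t => f (θ + t • v) - t * inner ℝ (f' θ) v + L / 2 * ‖v‖ ^ 2 * t ^ 2
  have hφ : ∀ t, HasDerivAt φ (inner ℝ (f' (θ + t • v) - f' θ) v + L * ‖v‖ ^ 2 * t) t := by
    intro t
    have hline : HasDerivAt (fun t : ℝ => θ + t • v) v t := by
      simpa using ((hasDerivAt_id t).smul_const v).const_add θ
    refine ((((hf (θ + t • v)).hasFDerivAt.comp_hasDerivAt t hline).sub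
      ((hasDerivAt_id t).mul_const (inner ℝ (f' θ) v))).add
      ((hasDerivAt_pow 2 t).const_mul (L / 2 * ‖v‖ ^ 2))).congr_deriv ?_
    simp [inner_sub_left]
    ring
  have hmono : MonotoneOn φ (Set.Icc 0 1) := by
    refine monotoneOn_of_hasDerivWithinAt_nonneg (convex_Icc 0 1)
      (fun t _ => (hφ t).continuousAt.continuousWithinAt)
      (fun t _ => (hφ t).hasDerivWithinAt) fun t ht => ?_
    rw [interior_Icc] at ht
    have hcs := abs_le.1 (abs_real_inner_le_norm (f' (θ + t • v) - f' θ) v)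
    have hlip := hL (θ + t • v) θ
    rw [add_sub_cancel_left, norm_smul, Real.norm_of_nonneg ht.1.le] at hlip
    nlinarith [mul_le_mul_of_nonneg_right hlip (norm_nonneg v)]
  have h01 := hmono (Set.left_mem_Icc.2 zero_le_one) (Set.right_mem_Icc.2 zero_le_one) zero_le_one
  simp only [φ, zero_smul, add_zero, one_smul, zero_mul, one_mul] at h01
  linarith

lemma mul_norm_gradient_sq_le_of_step {f : V → ℝ} {f' : V → V} {L α : ℝ}
    (hf : ∀ θ, HasGradientAt f (f' θ) θ) (hL : ∀ θ η, ‖f' θ - f' η‖ ≤ L * ‖θ - η‖)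
    (hα : 0 ≤ α) (hαL : α * L ≤ 1) (θ v : V) :
    α * ‖f' θ‖ ^ 2 ≤ 2 * (f (θ + α • v) - f θ) + α * ‖v - f' θ‖ ^ 2 := by
  have hdescent := add_inner_sub_le_of_lipschitz_gradient hf hL θ (α • v)
  have hquad : L / 2 * ‖α • v‖ ^ 2 ≤ α / 2 * ‖v‖ ^ 2 := by
    rw [norm_smul, Real.norm_of_nonneg hα, mul_pow]
    nlinarith [mul_le_mul_of_nonneg_right hαL (mul_nonneg hα (sq_nonneg ‖v‖))]
  have hpolar : ‖v - f' θ‖ ^ 2 = ‖v‖ ^ 2 - 2 * inner ℝ (f' θ) v + ‖f' θ‖ ^ 2 := by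
    rw [norm_sub_sq_real, real_inner_comm]
  rw [inner_smul_right] at hdescent
  rw [hpolar]
  linarith

end Ascent

/-! ### Mean-square errors of empirical means -/

section MeanSquare

variable {Ω W : Type*} [MeasurableSpace Ω] {μ : Measure Ω} [NormedAddCommGroup W]
  [InnerProductSpace ℝ W] [CompleteSpace W]

lemma integral_norm_sub_const_sq [IsFiniteMeasure μ] {f : Ω → W} (hf : MemLp f 2 μ) (c : W) :
    ∫ ω, ‖f ω - c‖ ^ 2 ∂μ =
      ∫ ω, ‖f ω‖ ^ 2 ∂μ - 2 * inner ℝ c (∫ ω, f ω ∂μ) + μ.real Set.univ * ‖c‖ ^ 2 := by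
  have hf1 : Integrable f μ := hf.integrable one_le_two
  have hf2 : Integrable (fun ω => ‖f ω‖ ^ 2) μ := hf.integrable_norm_pow two_ne_zero
  have hinner : Integrable (fun ω => 2 * inner ℝ c (f ω)) μ := (hf1.const_inner c).const_mul 2
  have hexpand : ∀ ω, ‖f ω - c‖ ^ 2 = ‖f ω‖ ^ 2 - 2 * inner ℝ c (f ω) + ‖c‖ ^ 2 := fun ω => by
    rw [norm_sub_sq_real, real_inner_comm]
  simp_rw [hexpand]
  rw [integral_add (by exact hf2.sub hinner) (integrable_const _), integral_sub hf2 hinner,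
    integral_const_mul, integral_inner (𝕜 := ℝ) hf1, integral_const, smul_eq_mul]

lemma norm_integral_sq_le_measureReal_mul [IsFiniteMeasure μ] {f : Ω → W} (hf : MemLp f 2 μ) :
    ‖∫ ω, f ω ∂μ‖ ^ 2 ≤ μ.real Set.univ * ∫ ω, ‖f ω‖ ^ 2 ∂μ := by
  rcases eq_zero_or_neZero μ with rfl | _
  · simp
  set ℓ := μ.real Set.univ
  set z := ∫ ω, f ω ∂μ
  have hℓ : 0 < ℓ := measureReal_univ_pos
  have hvar : 0 ≤ ∫ ω, ‖f ω‖ ^ 2 ∂μ - ‖z‖ ^ 2 / ℓ := by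
    calc 0 ≤ ∫ ω, ‖f ω - ℓ⁻¹ • z‖ ^ 2 ∂μ := integral_nonneg fun ω => sq_nonneg _
      _ = ∫ ω, ‖f ω‖ ^ 2 ∂μ - ‖z‖ ^ 2 / ℓ := by
          rw [integral_norm_sub_const_sq hf, real_inner_smul_left, real_inner_self_eq_norm_sq,
            norm_smul, norm_inv, Real.norm_of_nonneg hℓ.le]
          field_simp
          ring
  rw [sub_nonneg, div_le_iff₀ hℓ] at hvar
  linarith

lemma integral_norm_sub_integral_sq_le [IsProbabilityMeasure μ] {f : Ω → W} (hf : MemLp f 2 μ) :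
    ∫ ω, ‖f ω - ∫ ω', f ω' ∂μ‖ ^ 2 ∂μ ≤ ∫ ω, ‖f ω‖ ^ 2 ∂μ := by
  rw [integral_norm_sub_const_sq hf, real_inner_self_eq_norm_sq, probReal_univ]
  linarith [sq_nonneg ‖∫ ω, f ω ∂μ‖]

lemma integral_norm_sum_sq_of_indepFun [MeasurableSpace W] [BorelSpace W] [IsFiniteMeasure μ]
    {ι : Type*} [Fintype ι] {X : ι → Ω → W} (hX : ∀ i, MemLp (X i) 2 μ)
    (hzero : ∀ i, ∫ ω, X i ω ∂μ = 0) (hindep : Pairwise fun i j => IndepFun (X i) (X j) μ) :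
    ∫ ω, ‖∑ i, X i ω‖ ^ 2 ∂μ = ∑ i, ∫ ω, ‖X i ω‖ ^ 2 ∂μ := by
  have hX1 : ∀ i, Integrable (X i) μ := fun i => (hX i).integrable one_le_two
  have hintegrable : ∀ i j, Integrable (fun ω => inner ℝ (X i ω) (X j ω)) μ := by
    intro i j
    rcases eq_or_ne i j with rfl | hij
    · simpa only [real_inner_self_eq_norm_sq] using (hX i).integrable_norm_pow two_ne_zero
    · exact (hindep hij).integrable_bilin (hX1 i) (hX1 j) (innerSL ℝ)
  have horth : ∀ i j, j ≠ i → ∫ ω, inner ℝ (X i ω) (X j ω) ∂μ = 0 := by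
    intro i j hij
    refine ((hindep hij.symm).integral_bilin (hX1 i) (hX1 j) (innerSL ℝ)).trans ?_
    rw [hzero, hzero, map_zero]
  have hexpand : ∀ ω, ‖∑ i, X i ω‖ ^ 2 = ∑ i, ∑ j, inner ℝ (X i ω) (X j ω) := fun ω => by
    rw [← real_inner_self_eq_norm_sq, sum_inner]
    simp_rw [inner_sum]
  simp_rw [hexpand]
  rw [integral_finsetSum _ fun i _ => integrable_finsetSum _ fun j _ => hintegrable i j]
  refine Finset.sum_congr rfl fun i _ => ?_
  rw [integral_finsetSum _ fun j _ => hintegrable i j, Finset.sum_eq_single i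
    (fun j _ hj => horth i j hj) (by simp)]
  simp_rw [real_inner_self_eq_norm_sq]

lemma integral_norm_empirical_mean_sub_sq_le [IsProbabilityMeasure μ] {f : Ω → W}
    (hf : MemLp f 2 μ) {m : ℕ} (hm : 0 < m) :
    ∫ y : Fin m → Ω, ‖(m : ℝ)⁻¹ • ∑ i, f (y i) - ∫ ω, f ω ∂μ‖ ^ 2 ∂Measure.pi (fun _ => μ) ≤
      (∫ ω, ‖f ω‖ ^ 2 ∂μ) / m := by
  borelize W
  set z := ∫ ω, f ω ∂μ with hz
  let h : Ω → W := fun ω => f ω - z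
  have hh : MemLp h 2 μ := hf.sub (memLp_const z)
  have hh0 : ∫ ω, h ω ∂μ = 0 := by
    rw [integral_sub (hf.integrable one_le_two) (integrable_const z)]
    simp [hz]
  have hmean : ∀ y : Fin m → Ω, (m : ℝ)⁻¹ • ∑ i, f (y i) - z = (m : ℝ)⁻¹ • ∑ i, h (y i) := by
    intro y
    have hm0 : (m : ℝ) ≠ 0 := by positivity
    rw [Finset.sum_sub_distrib, smul_sub, Finset.sum_const, Finset.card_univ, Fintype.card_fin,
      ← Nat.cast_smul_eq_nsmul ℝ, inv_smul_smul₀ hm0]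
  have hcoord : ∀ i : Fin m,
      MeasurePreserving (Function.eval i) (Measure.pi fun _ : Fin m => μ) μ :=
    fun i => measurePreserving_eval _ i
  have hsum : ∫ y : Fin m → Ω, ‖∑ i, h (y i)‖ ^ 2 ∂Measure.pi (fun _ => μ) =
      m * ∫ ω, ‖h ω‖ ^ 2 ∂μ := by
    rw [integral_norm_sum_sq_of_indepFun (X := fun i (y : Fin m → Ω) => h (y i))
      (fun i => hh.comp_measurePreserving (hcoord i))
      (fun i => ((hcoord i).hasLaw.integral_comp hh.1).trans hh0)
      fun i j hij => (iIndepFun_pi fun _ => hh.1.aemeasurable).indepFun hij]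
    have hone : ∀ i : Fin m, ∫ y : Fin m → Ω, ‖h (y i)‖ ^ 2 ∂Measure.pi (fun _ => μ) =
        ∫ ω, ‖h ω‖ ^ 2 ∂μ := fun i =>
      (hcoord i).hasLaw.integral_comp (hh.integrable_norm_pow two_ne_zero).1
    simp [hone]
  simp_rw [hmean, norm_smul, mul_pow]
  rw [integral_const_mul, hsum]
  calc _ = (∫ ω, ‖h ω‖ ^ 2 ∂μ) / m := by
        rw [norm_inv, Real.norm_natCast]
        field_simp
    _ ≤ _ := by exact div_le_div_of_nonneg_right (integral_norm_sub_integral_sq_le hf) m.cast_nonneg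

end MeanSquare

/-! ### Independence and uniform indices -/

section Independence

variable {Ω α β : Type*} [MeasurableSpace Ω] {P : Measure Ω}
  [MeasurableSpace α] [MeasurableSpace β]

lemma integral_comp_le_of_indepFun [IsProbabilityMeasure P] {U : Ω → α} {W : Ω → β}
    (hU : AEMeasurable U P) (hW : AEMeasurable W P) (h : IndepFun U W P) {F : α × β → ℝ}
    (hF : Integrable F ((P.map U).prod (P.map W))) {B : ℝ}
    (hB : ∀ u, ∫ w, F (u, w) ∂P.map W ≤ B) : ∫ ω, F (U ω, W ω) ∂P ≤ B := by
  have := Measure.isProbabilityMeasure_map hU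
  have := Measure.isProbabilityMeasure_map hW
  have hlaw := (indepFun_iff_map_prod_eq_prod_map_map hU hW).1 h
  calc ∫ ω, F (U ω, W ω) ∂P = ∫ u, ∫ w, F (u, w) ∂P.map W ∂P.map U := by
        rw [← integral_prod F hF, ← hlaw, integral_map (hU.prodMk hW) (hlaw ▸ hF.1)]
    _ ≤ ∫ _, B ∂P.map U := integral_mono hF.integral_prod_left (integrable_const B) hB
    _ = B := by simp

lemma integrable_of_ae_mem_finite [MeasurableSingletonClass α] {μ : Measure α} [IsFiniteMeasure μ]
    {s : Set α} (hs : s.Finite) (h : ∀ᵐ a ∂μ, a ∈ s) (f : α → ℝ) : Integrable f μ := by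
  rw [← Measure.restrict_eq_self_of_ae_mem h]
  exact IntegrableOn.of_finite hs

lemma integral_uniformOn_finset [MeasurableSingletonClass α] (s : Finset α) (f : α → ℝ) :
    ∫ a, f a ∂uniformOn (s : Set α) = (s.card : ℝ)⁻¹ * ∑ a ∈ s, f a := by
  have hintegrable : IntegrableOn f s Measure.count := by
    rw [← (s : Set α).biUnion_of_singleton]
    simp [integrableOn_finset_iUnion]
  rw [uniformOn, ProbabilityTheory.cond, integral_smul_measure, setIntegral_finset s hintegrable]
  simp

section UniformIndex

variable [MeasurableSingletonClass α] [Countable α] [Finite β] [MeasurableSingletonClass β]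
  {s : Finset α} {R : Ω → α} {Z : Ω → β}

lemma ae_mem_of_hasLaw_uniformOn (hR : HasLaw R (uniformOn (s : Set α)) P) :
    ∀ᵐ ω ∂P, R ω ∈ s :=
  (hR.ae_iff .of_discrete).2 (ae_cond_mem (Finset.measurableSet s))

variable [IsProbabilityMeasure P]

lemma integrable_comp_of_hasLaw_uniformOn (hR : HasLaw R (uniformOn (s : Set α)) P)
    (hZ : AEMeasurable Z P) (F : α × β → ℝ) : Integrable (fun ω => F (R ω, Z ω)) P := by
  have hRZ : AEMeasurable (fun ω => (R ω, Z ω)) P := hR.aemeasurable.prodMk hZ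
  refine (integrable_of_ae_mem_finite (s := (s : Set α) ×ˢ Set.univ)
    (s.finite_toSet.prod Set.finite_univ) ?_ F).comp_aemeasurable hRZ
  rw [ae_map_iff hRZ (Set.to_countable _).measurableSet]
  simpa using ae_mem_of_hasLaw_uniformOn hR

lemma integral_comp_of_hasLaw_uniformOn (hR : HasLaw R (uniformOn (s : Set α)) P)
    (hZ : AEMeasurable Z P) (h : IndepFun R Z P) (F : α × β → ℝ) :
    ∫ ω, F (R ω, Z ω) ∂P = (s.card : ℝ)⁻¹ * ∑ a ∈ s, ∫ ω, F (a, Z ω) ∂P := by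
  have := Measure.isProbabilityMeasure_map hR.aemeasurable
  have := Measure.isProbabilityMeasure_map hZ
  have hRZ : AEMeasurable (fun ω => (R ω, Z ω)) P := hR.aemeasurable.prodMk hZ
  have hlaw := (indepFun_iff_map_prod_eq_prod_map_map hR.aemeasurable hZ).1 h
  have hF : Integrable F ((P.map R).prod (P.map Z)) := by
    rw [← hlaw, integrable_map_measure Measurable.of_discrete.aestronglyMeasurable hRZ]
    exact integrable_comp_of_hasLaw_uniformOn hR hZ F
  calc ∫ ω, F (R ω, Z ω) ∂P = ∫ a, ∫ z, F (a, z) ∂P.map Z ∂uniformOn (s : Set α) := by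
        rw [← hR.map_eq, ← integral_prod F hF, ← hlaw, integral_map hRZ (hlaw ▸ hF.1)]
    _ = (s.card : ℝ)⁻¹ * ∑ a ∈ s, ∫ ω, F (a, Z ω) ∂P := by
        simp_rw [integral_uniformOn_finset,
          integral_map hZ Measurable.of_discrete.aestronglyMeasurable]

end UniformIndex

end Independence

/-! ### Stochastic ascent -/

section StochasticAscent

variable {V β : Type*}

section Module

variable [AddCommGroup V] [Module ℝ V]

/-- Stochastic ascent with step size `α` from `θ₀` in the directions `G θ y`, where iteration `k`
uses the sample `z k`. -/
def stochAscent (G : V → β → V) (α : ℝ) (θ₀ : V) (z : ℕ → β) : ℕ → V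
  | 0 => θ₀
  | k + 1 => stochAscent G α θ₀ z k + α • G (stochAscent G α θ₀ z k) (z k)

lemma stochAscent_congr (G : V → β → V) (α : ℝ) (θ₀ : V) {z z' : ℕ → β} {k : ℕ}
    (h : ∀ j < k, z j = z' j) : stochAscent G α θ₀ z k = stochAscent G α θ₀ z' k := by
  induction k with
  | zero => rfl
  | succ k ih =>
    rw [stochAscent, stochAscent, ih fun j hj => h j (hj.trans k.lt_succ_self),
      h k k.lt_succ_self]

lemma exists_comp_stochAscent_eq {W : Type*} [Nonempty W] (G : V → β → V) (α : ℝ) (θ₀ : V)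
    (N : ℕ) (φ : V → W) : ∃ F : ℕ × (Set.Iio N → β) → W, ∀ k ≤ N, ∀ z,
      φ (stochAscent G α θ₀ z k) = F (k, fun j => z j) := by
  have hdep : ∀ k ≤ N, DependsOn (fun z => φ (stochAscent G α θ₀ z k)) (Set.Iio N) :=
    fun k hk z z' h =>
    congrArg φ (stochAscent_congr G α θ₀ fun j hj => h j (hj.trans_le hk))
  choose! F hF using fun k hk => dependsOn_iff_exists_comp.1 (hdep k hk)
  exact ⟨fun p => F p.1 p.2, fun k hk z => congrFun (hF k hk) z⟩

end Module

lemma sum_norm_gradient_stochAscent_sq_le [NormedAddCommGroup V] [InnerProductSpace ℝ V]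
    [CompleteSpace V] {f : V → ℝ} {f' : V → V}
    {L α v : ℝ} (hf : ∀ θ, HasGradientAt f (f' θ) θ)
    (hL : ∀ θ η, ‖f' θ - f' η‖ ≤ L * ‖θ - η‖) (hα : 0 ≤ α) (hαL : α * L ≤ 1)
    (hv : ∀ θ, f θ ≤ v) (G : V → β → V) (θ₀ : V) (z : ℕ → β) (N : ℕ) :
    α * ∑ k ∈ Finset.Icc 1 N, ‖f' (stochAscent G α θ₀ z k)‖ ^ 2 ≤
      2 * (v - f θ₀) + α * ∑ k ∈ Finset.range N,
        ‖G (stochAscent G α θ₀ z k) (z k) - f' (stochAscent G α θ₀ z k)‖ ^ 2 := by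
  let θ := stochAscent G α θ₀ z
  have htelescope : α * ∑ k ∈ Finset.range N, ‖f' (θ k)‖ ^ 2 ≤
      2 * (f (θ N) - f θ₀) + α * ∑ k ∈ Finset.range N, ‖G (θ k) (z k) - f' (θ k)‖ ^ 2 := by
    induction N with
    | zero => simp [θ, stochAscent]
    | succ N ih =>
      have hstep : α * ‖f' (θ N)‖ ^ 2 ≤
          2 * (f (θ (N + 1)) - f (θ N)) + α * ‖G (θ N) (z N) - f' (θ N)‖ ^ 2 :=
        mul_norm_gradient_sq_le_of_step hf hL hα hαL (θ N) (G (θ N) (z N))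
      rw [Finset.sum_range_succ, Finset.sum_range_succ]
      linarith
  -- A step in the exact gradient direction bounds the term of the last iterate.
  have hlast : α * ‖f' (θ N)‖ ^ 2 ≤ 2 * (v - f (θ N)) := by
    have hstep := mul_norm_gradient_sq_le_of_step hf hL hα hαL (θ N) (f' (θ N))
    rw [sub_self, norm_zero] at hstep
    linarith [hv (θ N + α • f' (θ N))]
  have hsub : ∑ k ∈ Finset.Icc 1 N, ‖f' (θ k)‖ ^ 2 ≤
      ∑ k ∈ Finset.range N, ‖f' (θ k)‖ ^ 2 + ‖f' (θ N)‖ ^ 2 := by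
    rw [← Finset.sum_range_succ]
    refine Finset.sum_le_sum_of_subset_of_nonneg (fun k hk => ?_) fun _ _ _ => sq_nonneg _
    exact Finset.mem_range_succ_iff.2 (Finset.mem_Icc.1 hk).2
  linarith [mul_le_mul_of_nonneg_left hsub hα]

section Sampling

variable {Ω : Type*} [MeasurableSpace Ω] {P : Measure Ω} [IsProbabilityMeasure P] [Finite β]
  [MeasurableSpace β] [MeasurableSingletonClass β] {z : ℕ → Ω → β} {N : ℕ}

lemma integrable_of_dependsOn (hz : ∀ k < N, AEMeasurable (z k) P) {φ : (ℕ → β) → ℝ}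
    (hφ : DependsOn φ (Set.Iio N)) : Integrable (fun ω => φ fun k => z k ω) P := by
  obtain ⟨F, rfl⟩ := dependsOn_iff_exists_comp.1 hφ
  exact Integrable.comp_aemeasurable (g := F) .of_finite
    (aemeasurable_pi_lambda (fun ω (k : Set.Iio N) => z k ω) fun k => hz k k.2)

lemma integral_comp_stochAscent_le [AddCommGroup V] [Module ℝ V] (G : V → β → V) (α : ℝ) (θ₀ : V)
    {k : ℕ} (hz : ∀ j ≤ k, AEMeasurable (z j) P)
    (hfresh : IndepFun (fun ω (j : Set.Iio k) => z j ω) (z k) P) {F : V → β → ℝ} {B : ℝ}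
    (hB : ∀ θ, ∫ y, F θ y ∂P.map (z k) ≤ B) :
    ∫ ω, F (stochAscent G α θ₀ (fun j => z j ω) k) (z k ω) ∂P ≤ B := by
  obtain ⟨Θ, hΘ⟩ := exists_comp_stochAscent_eq G α θ₀ k id
  have hpast : ∀ ω, stochAscent G α θ₀ (fun j => z j ω) k = Θ (k, fun j => z j ω) :=
    fun ω => hΘ k le_rfl _
  simp_rw [hpast]
  have hU : AEMeasurable (fun ω (j : Set.Iio k) => z j ω) P :=
    aemeasurable_pi_lambda _ fun j => hz j (Set.mem_Iio.1 j.2).le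
  have := Measure.isProbabilityMeasure_map hU
  have := Measure.isProbabilityMeasure_map (hz k le_rfl)
  exact integral_comp_le_of_indepFun hU (hz k le_rfl) hfresh (F := fun p => F (Θ (k, p.1)) p.2)
    .of_finite fun u => hB (Θ (k, u))

section UniformIndex

variable {R : Ω → ℕ}

lemma integrable_comp_stochAscent_uniformOn [AddCommGroup V] [Module ℝ V]
    (hz : ∀ k < N, AEMeasurable (z k) P) (hR : HasLaw R (uniformOn (Set.Icc 1 N)) P)
    (G : V → β → V) (α : ℝ) (θ₀ : V) (φ : V → ℝ) :
    Integrable (fun ω => φ (stochAscent G α θ₀ (fun k => z k ω) (R ω))) P := by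
  obtain ⟨F, hF⟩ := exists_comp_stochAscent_eq G α θ₀ N φ
  rw [← Finset.coe_Icc] at hR
  refine (integrable_comp_of_hasLaw_uniformOn hR
    (aemeasurable_pi_lambda (fun ω (k : Set.Iio N) => z k ω) fun k => hz k k.2) F).congr ?_
  filter_upwards [ae_mem_of_hasLaw_uniformOn hR] with ω hω
  rw [hF _ (Finset.mem_Icc.1 hω).2]

lemma integral_comp_stochAscent_uniformOn [AddCommGroup V] [Module ℝ V]
    (hz : ∀ k < N, AEMeasurable (z k) P) (hR : HasLaw R (uniformOn (Set.Icc 1 N)) P)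
    (hRz : IndepFun R (fun ω (k : Set.Iio N) => z k ω) P)
    (G : V → β → V) (α : ℝ) (θ₀ : V) (φ : V → ℝ) :
    ∫ ω, φ (stochAscent G α θ₀ (fun k => z k ω) (R ω)) ∂P =
      (N : ℝ)⁻¹ * ∑ k ∈ Finset.Icc 1 N, ∫ ω, φ (stochAscent G α θ₀ (fun k => z k ω) k) ∂P := by
  obtain ⟨F, hF⟩ := exists_comp_stochAscent_eq G α θ₀ N φ
  rw [← Finset.coe_Icc] at hR
  calc ∫ ω, φ (stochAscent G α θ₀ (fun k => z k ω) (R ω)) ∂P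
      = ∫ ω, F (R ω, fun k => z k ω) ∂P := by
        refine integral_congr_ae ?_
        filter_upwards [ae_mem_of_hasLaw_uniformOn hR] with ω hω
        rw [hF _ (Finset.mem_Icc.1 hω).2]
    _ = (N : ℝ)⁻¹ * ∑ k ∈ Finset.Icc 1 N, ∫ ω, F (k, fun k => z k ω) ∂P := by
        rw [integral_comp_of_hasLaw_uniformOn hR
          (aemeasurable_pi_lambda (fun ω (k : Set.Iio N) => z k ω) fun k => hz k k.2) hRz F,
          Nat.card_Icc, Nat.add_sub_cancel]
    _ = _ := by
        refine congrArg _ (Finset.sum_congr rfl fun k hk => ?_)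
        simp_rw [hF k (Finset.mem_Icc.1 hk).2]

end UniformIndex

lemma sum_integral_norm_gradient_stochAscent_sq_le [NormedAddCommGroup V]
    [InnerProductSpace ℝ V] [CompleteSpace V] {f : V → ℝ} {f' : V → V} {L α v : ℝ}
    (hf : ∀ θ, HasGradientAt f (f' θ) θ) (hL : ∀ θ η, ‖f' θ - f' η‖ ≤ L * ‖θ - η‖)
    (hα : 0 ≤ α) (hαL : α * L ≤ 1) (hv : ∀ θ, f θ ≤ v) (G : V → β → V) (θ₀ : V)
    (hz : ∀ k < N, AEMeasurable (z k) P) :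
    α * ∑ k ∈ Finset.Icc 1 N, ∫ ω, ‖f' (stochAscent G α θ₀ (fun j => z j ω) k)‖ ^ 2 ∂P ≤
      2 * (v - f θ₀) + α * ∑ k ∈ Finset.range N,
        ∫ ω, ‖G (stochAscent G α θ₀ (fun j => z j ω) k) (z k ω) -
          f' (stochAscent G α θ₀ (fun j => z j ω) k)‖ ^ 2 ∂P := by
  let θ : Ω → ℕ → V := fun ω => stochAscent G α θ₀ fun k => z k ω
  have hgrad : ∀ k ∈ Finset.Icc 1 N, Integrable (fun ω => ‖f' (θ ω k)‖ ^ 2) P := fun k hk =>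
    integrable_of_dependsOn hz (φ := fun z => ‖f' (stochAscent G α θ₀ z k)‖ ^ 2) fun z z' h => by
      simp only [stochAscent_congr G α θ₀ fun j hj => h j (hj.trans_le (Finset.mem_Icc.1 hk).2)]
  have herr : ∀ k ∈ Finset.range N,
      Integrable (fun ω => ‖G (θ ω k) (z k ω) - f' (θ ω k)‖ ^ 2) P := fun k hk =>
    have hk := Finset.mem_range.1 hk
    integrable_of_dependsOn hz (φ := fun z =>
      ‖G (stochAscent G α θ₀ z k) (z k) - f' (stochAscent G α θ₀ z k)‖ ^ 2) fun z z' h => by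
        simp only [stochAscent_congr G α θ₀ fun j hj => h j (hj.trans hk), h k hk]
  calc α * ∑ k ∈ Finset.Icc 1 N, ∫ ω, ‖f' (θ ω k)‖ ^ 2 ∂P
      = ∫ ω, α * ∑ k ∈ Finset.Icc 1 N, ‖f' (θ ω k)‖ ^ 2 ∂P := by
        rw [integral_const_mul, integral_finsetSum _ hgrad]
    _ ≤ ∫ ω, (2 * (v - f θ₀) +
          α * ∑ k ∈ Finset.range N, ‖G (θ ω k) (z k ω) - f' (θ ω k)‖ ^ 2) ∂P :=
        integral_mono ((integrable_finsetSum _ hgrad).const_mul α)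
          ((integrable_const _).add ((integrable_finsetSum _ herr).const_mul α)) fun ω =>
          sum_norm_gradient_stochAscent_sq_le hf hL hα hαL hv G θ₀ _ N
    _ = _ := by
        rw [integral_add (integrable_const _) ((integrable_finsetSum _ herr).const_mul α),
          integral_const, probReal_univ, one_smul, integral_const_mul, integral_finsetSum _ herr]

theorem integral_norm_gradient_stochAscent_sq_le [NormedAddCommGroup V] [InnerProductSpace ℝ V]
    [CompleteSpace V] {f : V → ℝ} {f' : V → V} {L α v B : ℝ}
    (hf : ∀ θ, HasGradientAt f (f' θ) θ) (hL : ∀ θ η, ‖f' θ - f' η‖ ≤ L * ‖θ - η‖)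
    (hα : 0 < α) (hαL : α * L ≤ 1) (hv : ∀ θ, f θ ≤ v) (G : V → β → V) (θ₀ : V) (hN : 0 < N)
    (hz : ∀ k < N, AEMeasurable (z k) P)
    (hfresh : ∀ k < N, IndepFun (fun ω (j : Set.Iio k) => z j ω) (z k) P)
    (hB : ∀ k < N, ∀ θ, ∫ y, ‖G θ y - f' θ‖ ^ 2 ∂P.map (z k) ≤ B)
    {R : Ω → ℕ} (hR : HasLaw R (uniformOn (Set.Icc 1 N)) P)
    (hRz : IndepFun R (fun ω (k : Set.Iio N) => z k ω) P) :
    ∫ ω, ‖f' (stochAscent G α θ₀ (fun k => z k ω) (R ω))‖ ^ 2 ∂P ≤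
      2 * (v - f θ₀) / (N * α) + B := by
  have hsum : α * ∑ k ∈ Finset.Icc 1 N,
      ∫ ω, ‖f' (stochAscent G α θ₀ (fun j => z j ω) k)‖ ^ 2 ∂P ≤
        2 * (v - f θ₀) + α * (N * B) := by
    refine (sum_integral_norm_gradient_stochAscent_sq_le hf hL hα.le hαL hv G θ₀ hz).trans ?_
    have herr : ∀ k ∈ Finset.range N, ∫ ω, ‖G (stochAscent G α θ₀ (fun j => z j ω) k) (z k ω) -
        f' (stochAscent G α θ₀ (fun j => z j ω) k)‖ ^ 2 ∂P ≤ B := fun k hk =>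
      have hk := Finset.mem_range.1 hk
      integral_comp_stochAscent_le G α θ₀ (fun j hj => hz j (hj.trans_lt hk)) (hfresh k hk)
        (F := fun θ y => ‖G θ y - f' θ‖ ^ 2) (hB k hk)
    gcongr
    simpa using Finset.sum_le_card_nsmul _ _ _ herr
  rw [integral_comp_stochAscent_uniformOn hz hR hRz G α θ₀ fun θ => ‖f' θ‖ ^ 2]
  have hN' : (0 : ℝ) < N := Nat.cast_pos.2 hN
  rw [inv_mul_le_iff₀ hN']
  refine le_of_mul_le_mul_left (hsum.trans_eq ?_) hα
  field_simp

end Sampling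

end StochasticAscent

/-! ### Importance sampling -/

section Sublevel

lemma measurable_sublevel {E : Type*} (f : E → ℝ) : Measurable fun x => {e | f e ≤ x} :=
  measurable_set_iff.2 fun _ => measurableSet_setOfPred.1 measurableSet_Ici

/-- The image of the length on `(a, b]` under `x ↦ {e | f e ≤ x}`. For finite `E` it turns an
integral over thresholds `x` into a finite sum over sets. -/
def sublevelMeasure {E : Type*} (f : E → ℝ) (a b : ℝ) : Measure (Set E) :=
  (volume.restrict (Set.Ioc a b)).map fun x => {e | f e ≤ x}

instance {E : Type*} (f : E → ℝ) (a b : ℝ) : IsFiniteMeasure (sublevelMeasure f a b) := by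
  rw [sublevelMeasure]; infer_instance

lemma sublevelMeasure_real_univ {E : Type*} (f : E → ℝ) {a b : ℝ} (hab : a ≤ b) :
    (sublevelMeasure f a b).real Set.univ = b - a := by
  rw [sublevelMeasure, map_measureReal_apply (measurable_sublevel f) .univ, Set.preimage_univ,
    measureReal_restrict_apply_univ, Real.volume_real_Ioc_of_le hab]

variable {E F : Type*} [Finite E] [NormedAddCommGroup F]

lemma intervalIntegrable_comp_sublevel (f : E → ℝ) {a b : ℝ} (hab : a ≤ b) (φ : Set E → F) :
    IntervalIntegrable (fun x => φ {e | f e ≤ x}) volume a b := by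
  rw [intervalIntegrable_iff_integrableOn_Ioc_of_le hab]
  exact (integrable_map_measure .of_discrete (measurable_sublevel f).aemeasurable).1
    (Integrable.of_finite (μ := sublevelMeasure f a b))

lemma intervalIntegral_comp_sublevel [NormedSpace ℝ F] (f : E → ℝ) {a b : ℝ} (hab : a ≤ b)
    (φ : Set E → F) :
    ∫ x in a..b, φ {e | f e ≤ x} = ∫ c, φ c ∂sublevelMeasure f a b := by
  rw [intervalIntegral.integral_of_le hab, sublevelMeasure,
    integral_map (measurable_sublevel f).aemeasurable .of_discrete]

end Sublevel

/-- A family of laws on `E` that is given by the likelihood ratios with respect to one sampling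
law and depends smoothly on a parameter. The score is the gradient of the logarithm of the
ratio. -/
structure ImportanceModel (E V : Type*) [MeasurableSpace E] [NormedAddCommGroup V]
    [InnerProductSpace ℝ V] [CompleteSpace V] where
  law : Measure E
  [isProbabilityMeasure_law : IsProbabilityMeasure law]
  ratio : V → E → ℝ
  ratio_nonneg : ∀ θ e, 0 ≤ ratio θ e
  integral_ratio : ∀ θ, ∫ e, ratio θ e ∂law = 1
  ratioBound : ℝ
  ratio_le : ∀ θ, ∀ᵐ e ∂law, ratio θ e ≤ ratioBound
  score : V → E → V
  hasGradientAt_ratio : ∀ θ e, HasGradientAt (fun η => ratio η e) (ratio θ e • score θ e) θ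
  scoreBound : ℝ
  norm_score_le : ∀ θ e, ‖score θ e‖ ≤ scoreBound
  differentiable_score : ∀ e, Differentiable ℝ fun θ => score θ e
  hessBound : ℝ
  norm_fderiv_score_le : ∀ θ e, ‖fderiv ℝ (fun η => score η e) θ‖ ≤ hessBound

namespace ImportanceModel

attribute [instance] isProbabilityMeasure_law

variable {E V : Type*} [MeasurableSpace E] [NormedAddCommGroup V] [InnerProductSpace ℝ V]
  [CompleteSpace V] (Q : ImportanceModel E V) {m : ℕ}

/-- The probability of `c` under the parameter `θ`. -/
def prob (θ : V) (c : Set E) : ℝ := ∫ e in c, Q.ratio θ e ∂Q.law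

/-- The gradient of `prob` in the parameter. -/
def gradProb (θ : V) (c : Set E) : V := ∫ e in c, Q.ratio θ e • Q.score θ e ∂Q.law

/-- The importance sampling estimate of `prob` from the samples `y`, clipped at `1`. -/
def probEst (θ : V) (y : Fin m → E) (c : Set E) : ℝ :=
  min ((m : ℝ)⁻¹ * ∑ i, c.indicator (Q.ratio θ) (y i)) 1

/-- The importance sampling estimate of `gradProb` from the samples `y`. -/
def gradProbEst (θ : V) (y : Fin m → E) (c : Set E) : V :=
  (m : ℝ)⁻¹ • ∑ i, c.indicator (fun e => Q.ratio θ e • Q.score θ e) (y i)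

/-- The objective: the integral of the distorted probabilities `g (P cᶜ)` over the sets `c`. -/
def value (g : ℝ → ℝ) (ℓ : Measure (Set E)) (θ : V) : ℝ := ∫ c, g (1 - Q.prob θ c) ∂ℓ

/-- The gradient of `value`. -/
def gradValue (g : ℝ → ℝ) (ℓ : Measure (Set E)) (θ : V) : V :=
  ∫ c, -(derivWithin g (Set.Icc 0 1) (1 - Q.prob θ c) • Q.gradProb θ c) ∂ℓ

/-- The plug-in estimate of `gradValue` from the samples `y`. -/
def gradValueEst (g : ℝ → ℝ) (ℓ : Measure (Set E)) (θ : V) (y : Fin m → E) : V :=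
  ∫ c, -(derivWithin g (Set.Icc 0 1) (1 - Q.probEst θ y c) • Q.gradProbEst θ y c) ∂ℓ

/-- A Lipschitz constant of `gradValue` for a distortion whose derivative is bounded by `C` and
Lipschitz with constant `L`. -/
def gradLip (ℓ : Measure (Set E)) (C L : ℝ) : ℝ :=
  (C * (Q.hessBound + Q.scoreBound ^ 2) + L * Q.scoreBound ^ 2) * ℓ.real Set.univ

lemma norm_ratio_smul_score_le (θ : V) (e : E) :
    ‖Q.ratio θ e • Q.score θ e‖ ≤ Q.ratio θ e * Q.scoreBound := by
  rw [norm_smul, Real.norm_of_nonneg (Q.ratio_nonneg θ e)]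
  exact mul_le_mul_of_nonneg_left (Q.norm_score_le θ e) (Q.ratio_nonneg θ e)

lemma scoreBound_nonneg : 0 ≤ Q.scoreBound :=
  have ⟨e⟩ := Q.law.nonempty_of_neZero
  (norm_nonneg _).trans (Q.norm_score_le 0 e)

lemma hessBound_nonneg : 0 ≤ Q.hessBound :=
  have ⟨e⟩ := Q.law.nonempty_of_neZero
  (norm_nonneg _).trans (Q.norm_fderiv_score_le 0 e)

lemma gradLip_nonneg {g : ℝ → ℝ} {C L : ℝ} (hg : HasLipschitzDerivOn g (Set.Icc 0 1) C L)
    (ℓ : Measure (Set E)) : 0 ≤ Q.gradLip ℓ C L := by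
  have hC := hg.bound_nonneg ⟨0, by simp⟩
  have hL := hg.lipschitz_nonneg ⟨0, by simp, 1, by simp, zero_ne_one⟩
  have hH := Q.hessBound_nonneg
  unfold gradLip
  positivity

lemma one_sub_probEst_mem_Icc (θ : V) (y : Fin m → E) (c : Set E) :
    1 - Q.probEst θ y c ∈ Set.Icc (0 : ℝ) 1 := by
  have h0 : 0 ≤ Q.probEst θ y c := le_min (mul_nonneg (by positivity) <| Finset.sum_nonneg
    fun i _ => Set.indicator_nonneg (fun e _ => Q.ratio_nonneg θ e) (y i)) zero_le_one
  have h1 : Q.probEst θ y c ≤ 1 := min_le_right _ _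
  constructor <;> linarith

variable [Finite E] [MeasurableSingletonClass E]

lemma norm_setIntegral_le {W : Type*} [NormedAddCommGroup W] [NormedSpace ℝ W] (θ : V) {K : ℝ}
    {f : E → W} (hf : ∀ e, ‖f e‖ ≤ Q.ratio θ e * K) (c : Set E) :
    ‖∫ e in c, f e ∂Q.law‖ ≤ K :=
  calc ‖∫ e in c, f e ∂Q.law‖ ≤ ∫ e in c, ‖f e‖ ∂Q.law := norm_integral_le_integral_norm f
    _ ≤ ∫ e, ‖f e‖ ∂Q.law := setIntegral_le_integral .of_finite (ae_of_all _ fun _ => norm_nonneg _)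
    _ ≤ ∫ e, Q.ratio θ e * K ∂Q.law := integral_mono .of_finite .of_finite hf
    _ = K := by rw [integral_mul_const, Q.integral_ratio, one_mul]

lemma one_sub_prob_mem_Icc (θ : V) (c : Set E) : 1 - Q.prob θ c ∈ Set.Icc (0 : ℝ) 1 := by
  have h0 : 0 ≤ Q.prob θ c := integral_nonneg (Q.ratio_nonneg θ)
  have h1 : ‖Q.prob θ c‖ ≤ 1 := Q.norm_setIntegral_le θ
    (fun e => by rw [Real.norm_of_nonneg (Q.ratio_nonneg θ e), mul_one]) c
  rw [Real.norm_of_nonneg h0] at h1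
  constructor <;> linarith

lemma one_le_ratioBound : 1 ≤ Q.ratioBound := by
  simpa [Q.integral_ratio] using integral_mono_ae .of_finite .of_finite (Q.ratio_le 0)

lemma bddAbove_range_value {g : ℝ → ℝ} (hg : BddAbove (g '' Set.Icc 0 1)) (ℓ : Measure (Set E))
    [IsFiniteMeasure ℓ] : BddAbove (Set.range (Q.value g ℓ)) := by
  obtain ⟨B, hB⟩ := hg
  refine ⟨∫ _, B ∂ℓ, Set.forall_mem_range.2 fun θ => ?_⟩
  exact integral_mono .of_finite .of_finite fun c =>
    hB (Set.mem_image_of_mem g (Q.one_sub_prob_mem_Icc θ c))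

lemma hasGradientAt_prob (θ : V) (c : Set E) :
    HasGradientAt (fun η => Q.prob η c) (Q.gradProb θ c) θ :=
  hasGradientAt_integral_of_finite (Q.law.restrict c) (Q.hasGradientAt_ratio θ)

lemma norm_gradProb_le (θ : V) (c : Set E) : ‖Q.gradProb θ c‖ ≤ Q.scoreBound :=
  Q.norm_setIntegral_le θ (Q.norm_ratio_smul_score_le θ) c

lemma abs_prob_sub_le (θ η : V) (c : Set E) :
    |Q.prob θ c - Q.prob η c| ≤ Q.scoreBound * ‖θ - η‖ :=
  norm_sub_le_of_hasGradientAt (fun θ => Q.hasGradientAt_prob θ c)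
    (fun θ => Q.norm_gradProb_le θ c) θ η

lemma norm_gradProb_sub_le (θ η : V) (c : Set E) :
    ‖Q.gradProb θ c - Q.gradProb η c‖ ≤ (Q.hessBound + Q.scoreBound ^ 2) * ‖θ - η‖ := by
  let f' : V → E → V →L[ℝ] V := fun θ e =>
    Q.ratio θ e • fderiv ℝ (fun η => Q.score η e) θ +
      (innerSL ℝ (Q.ratio θ e • Q.score θ e)).smulRight (Q.score θ e)
  have hf' : ∀ θ e, HasFDerivAt (fun η => Q.ratio η e • Q.score η e) (f' θ e) θ := fun θ e =>
    (Q.hasGradientAt_ratio θ e).hasFDerivAt.smul (Q.differentiable_score e θ).hasFDerivAt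
  have hbound : ∀ θ e, ‖f' θ e‖ ≤ Q.ratio θ e * (Q.hessBound + Q.scoreBound ^ 2) := by
    intro θ e
    have hratio := Q.ratio_nonneg θ e
    refine (norm_add_le _ _).trans ?_
    rw [norm_smul, ContinuousLinearMap.norm_smulRight_apply, innerSL_apply_norm, norm_smul,
      Real.norm_of_nonneg hratio, mul_add, mul_assoc, ← sq]
    gcongr
    · exact Q.norm_fderiv_score_le θ e
    · exact Q.norm_score_le θ e
  exact convex_univ.norm_image_sub_le_of_norm_hasFDerivWithin_le (f := fun θ => Q.gradProb θ c)
    (fun x _ => (hasFDerivAt_integral_of_finite (Q.law.restrict c) (hf' x)).hasFDerivWithinAt)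
    (fun x _ => Q.norm_setIntegral_le x (hbound x) c) (Set.mem_univ η) (Set.mem_univ θ)

lemma integral_norm_empirical_mean_indicator_sub_sq_le {W : Type*} [NormedAddCommGroup W]
    [InnerProductSpace ℝ W] [CompleteSpace W] (θ : V) {K : ℝ} (hK : 0 ≤ K) {f : E → W}
    (hf : ∀ e, ‖f e‖ ≤ Q.ratio θ e * K) (hm : 0 < m) (c : Set E) :
    ∫ y : Fin m → E, ‖(m : ℝ)⁻¹ • ∑ i, c.indicator f (y i) - ∫ e in c, f e ∂Q.law‖ ^ 2
      ∂Measure.pi (fun _ => Q.law) ≤ (Q.ratioBound * K) ^ 2 / m := by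
  have hbound : ∀ᵐ e ∂Q.law, ‖c.indicator f e‖ ^ 2 ≤ (Q.ratioBound * K) ^ 2 := by
    filter_upwards [Q.ratio_le θ] with e he
    exact pow_le_pow_left₀ (norm_nonneg _) (((norm_indicator_le_norm_self f e).trans (hf e)).trans
      (mul_le_mul_of_nonneg_right he hK)) 2
  rw [← integral_indicator (Set.toFinite c).measurableSet]
  refine (integral_norm_empirical_mean_sub_sq_le .of_discrete hm).trans ?_
  gcongr
  simpa using integral_mono_ae .of_finite .of_finite hbound

lemma integral_norm_gradProbEst_sub_sq_le (hm : 0 < m) (θ : V) (c : Set E) :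
    ∫ y : Fin m → E, ‖Q.gradProbEst θ y c - Q.gradProb θ c‖ ^ 2 ∂Measure.pi (fun _ => Q.law) ≤
      (Q.ratioBound * Q.scoreBound) ^ 2 / m :=
  Q.integral_norm_empirical_mean_indicator_sub_sq_le θ Q.scoreBound_nonneg
    (Q.norm_ratio_smul_score_le θ) hm c

lemma integral_probEst_sub_sq_le (hm : 0 < m) (θ : V) (c : Set E) :
    ∫ y : Fin m → E, (Q.probEst θ y c - Q.prob θ c) ^ 2 ∂Measure.pi (fun _ => Q.law) ≤
      Q.ratioBound ^ 2 / m := by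
  have hclip : ∀ y : Fin m → E, (Q.probEst θ y c - Q.prob θ c) ^ 2 ≤
      ‖(m : ℝ)⁻¹ • ∑ i, c.indicator (Q.ratio θ) (y i) - Q.prob θ c‖ ^ 2 := fun y => by
    have h := abs_min_sub_min_le_max ((m : ℝ)⁻¹ * ∑ i, c.indicator (Q.ratio θ) (y i)) 1
      (Q.prob θ c) 1
    have hprob : Q.prob θ c ≤ 1 := sub_nonneg.1 (Q.one_sub_prob_mem_Icc θ c).1
    rw [min_eq_left hprob, sub_self, abs_zero, max_eq_left (abs_nonneg _)] at h
    exact sq_le_sq.2 (by simpa [probEst] using h)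
  refine (integral_mono .of_finite .of_finite hclip).trans ?_
  refine (Q.integral_norm_empirical_mean_indicator_sub_sq_le θ zero_le_one
    (fun e => ?_) hm c).trans_eq (by rw [mul_one])
  rw [Real.norm_of_nonneg (Q.ratio_nonneg θ e), mul_one]

section Value

variable {g : ℝ → ℝ} {ℓ : Measure (Set E)} [IsFiniteMeasure ℓ] {C L : ℝ}
  (hg : HasLipschitzDerivOn g (Set.Icc 0 1) C L)

include hg

lemma hasGradientAt_value (θ : V) : HasGradientAt (Q.value g ℓ) (Q.gradValue g ℓ θ) θ :=
  hasGradientAt_integral_of_finite ℓ fun c => hasGradientAt_comp_one_sub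
    (hg.hasDerivWithinAt _ (Q.one_sub_prob_mem_Icc θ c)) (Q.hasGradientAt_prob θ c)
    fun η => Q.one_sub_prob_mem_Icc η c

lemma norm_gradValue_le (θ : V) :
    ‖Q.gradValue g ℓ θ‖ ≤ C * Q.scoreBound * ℓ.real Set.univ := by
  refine norm_integral_le_of_norm_le_const (ae_of_all _ fun c => ?_)
  have hderiv := hg.abs_derivWithin_le _ (Q.one_sub_prob_mem_Icc θ c)
  rw [norm_neg, norm_smul]
  exact mul_le_mul hderiv (Q.norm_gradProb_le θ c) (norm_nonneg _) ((abs_nonneg _).trans hderiv)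

lemma norm_gradValue_sub_le (θ η : V) :
    ‖Q.gradValue g ℓ θ - Q.gradValue g ℓ η‖ ≤ Q.gradLip ℓ C L * ‖θ - η‖ := by
  rw [gradValue, gradValue, ← integral_sub .of_finite .of_finite, gradLip, mul_right_comm]
  refine norm_integral_le_of_norm_le_const (ae_of_all _ fun c => ?_)
  have hθ := Q.one_sub_prob_mem_Icc θ c
  have hη := Q.one_sub_prob_mem_Icc η c
  have hprob : |1 - Q.prob θ c - (1 - Q.prob η c)| ≤ Q.scoreBound * ‖θ - η‖ := by
    rw [sub_sub_sub_cancel_left, abs_sub_comm]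
    exact Q.abs_prob_sub_le θ η c
  rw [← norm_neg, neg_sub_neg, neg_sub]
  refine (hg.norm_smul_sub_smul_le hθ hη _ _).trans ?_
  have hC := hg.bound_nonneg ⟨_, hθ⟩
  have hL := hg.lipschitz_nonneg ⟨0, by simp, 1, by simp, zero_ne_one⟩
  have hS := Q.scoreBound_nonneg
  calc _ ≤ C * ((Q.hessBound + Q.scoreBound ^ 2) * ‖θ - η‖) +
        L * (Q.scoreBound * ‖θ - η‖) * Q.scoreBound := by
        gcongr
        · exact Q.norm_gradProb_sub_le θ η c
        · exact Q.norm_gradProb_le η c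
    _ = _ := by ring

lemma norm_derivWithin_smul_gradProbEst_sub_sq_le (θ : V) (y : Fin m → E) (c : Set E) :
    ‖derivWithin g (Set.Icc 0 1) (1 - Q.probEst θ y c) • Q.gradProbEst θ y c -
      derivWithin g (Set.Icc 0 1) (1 - Q.prob θ c) • Q.gradProb θ c‖ ^ 2 ≤
      2 * C ^ 2 * ‖Q.gradProbEst θ y c - Q.gradProb θ c‖ ^ 2 +
        2 * (L * Q.scoreBound) ^ 2 * (Q.probEst θ y c - Q.prob θ c) ^ 2 := by
  have herr := hg.norm_smul_sub_smul_le (Q.one_sub_probEst_mem_Icc θ y c)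
    (Q.one_sub_prob_mem_Icc θ c) (Q.gradProbEst θ y c) (Q.gradProb θ c)
  rw [sub_sub_sub_cancel_left, abs_sub_comm] at herr
  have hL := hg.lipschitz_nonneg ⟨0, by simp, 1, by simp, zero_ne_one⟩
  calc _ ≤ (C * ‖Q.gradProbEst θ y c - Q.gradProb θ c‖ +
        L * |Q.probEst θ y c - Q.prob θ c| * Q.scoreBound) ^ 2 := by
        refine pow_le_pow_left₀ (norm_nonneg _) (herr.trans ?_) 2
        gcongr
        exact Q.norm_gradProb_le θ c
    _ ≤ 2 * ((C * ‖Q.gradProbEst θ y c - Q.gradProb θ c‖) ^ 2 +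
        (L * |Q.probEst θ y c - Q.prob θ c| * Q.scoreBound) ^ 2) := add_sq_le
    _ = _ := by simp only [mul_pow, sq_abs]; ring

lemma integral_norm_derivWithin_smul_gradProbEst_sub_sq_le (hm : 0 < m) (θ : V) (c : Set E) :
    ∫ y : Fin m → E, ‖derivWithin g (Set.Icc 0 1) (1 - Q.probEst θ y c) • Q.gradProbEst θ y c -
      derivWithin g (Set.Icc 0 1) (1 - Q.prob θ c) • Q.gradProb θ c‖ ^ 2
      ∂Measure.pi (fun _ => Q.law) ≤
      2 * (Q.ratioBound * Q.scoreBound) ^ 2 * (C ^ 2 + L ^ 2) / m := by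
  refine (integral_mono .of_finite .of_finite fun y =>
    Q.norm_derivWithin_smul_gradProbEst_sub_sq_le hg θ y c).trans ?_
  rw [integral_add .of_finite .of_finite, integral_const_mul, integral_const_mul]
  calc _ ≤ 2 * C ^ 2 * ((Q.ratioBound * Q.scoreBound) ^ 2 / m) +
        2 * (L * Q.scoreBound) ^ 2 * (Q.ratioBound ^ 2 / m) := by
        gcongr
        · exact Q.integral_norm_gradProbEst_sub_sq_le hm θ c
        · exact Q.integral_probEst_sub_sq_le hm θ c
    _ = _ := by ring

lemma integral_norm_gradValueEst_sub_sq_le (hm : 0 < m) (θ : V) :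
    ∫ y : Fin m → E, ‖Q.gradValueEst g ℓ θ y - Q.gradValue g ℓ θ‖ ^ 2
      ∂Measure.pi (fun _ => Q.law) ≤
      ℓ.real Set.univ ^ 2 * (2 * (Q.ratioBound * Q.scoreBound) ^ 2 * (C ^ 2 + L ^ 2) / m) := by
  let err : (Fin m → E) → Set E → V := fun y c =>
    derivWithin g (Set.Icc 0 1) (1 - Q.probEst θ y c) • Q.gradProbEst θ y c -
      derivWithin g (Set.Icc 0 1) (1 - Q.prob θ c) • Q.gradProb θ c
  have hpointwise : ∀ y, ‖Q.gradValueEst g ℓ θ y - Q.gradValue g ℓ θ‖ ^ 2 ≤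
      ℓ.real Set.univ * ∫ c, ‖err y c‖ ^ 2 ∂ℓ := fun y => by
    rw [gradValueEst, gradValue, integral_neg, integral_neg, neg_sub_neg, norm_sub_rev,
      ← integral_sub .of_finite .of_finite]
    exact norm_integral_sq_le_measureReal_mul .of_discrete
  refine (integral_mono .of_finite .of_finite hpointwise).trans ?_
  rw [integral_const_mul, integral_integral_swap .of_finite, sq, mul_assoc]
  gcongr
  refine (integral_mono .of_finite .of_finite fun c =>
    Q.integral_norm_derivWithin_smul_gradProbEst_sub_sq_le hg hm θ c).trans_eq ?_
  rw [integral_const, smul_eq_mul]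

end Value

end ImportanceModel

section Batches

variable {Ω E : Type*} [MeasurableSpace Ω] [MeasurableSpace E] {P : Measure Ω}
  {N m : ℕ} {Y : ℕ → Fin m → Ω → E}

lemma hasLaw_batch [IsProbabilityMeasure P] {ν : Measure E} {k : ℕ} (hk : k < N)
    (hlaw : ∀ i, HasLaw (Y k i) ν P)
    (hindep : iIndepFun (fun ki : Fin N × Fin m => Y ki.1 ki.2) P) :
    HasLaw (fun ω i => Y k i ω) (Measure.pi fun _ => ν) P where
  aemeasurable := aemeasurable_pi_lambda _ fun i => (hlaw i).aemeasurable
  map_eq := by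
    have hbatch : iIndepFun (fun i => Y k i) P :=
      hindep.precomp (g := fun i => (⟨k, hk⟩, i)) fun i j hij => (Prod.ext_iff.1 hij).2
    rw [(iIndepFun_iff_map_fun_eq_pi_map fun i => (hlaw i).aemeasurable).1 hbatch]
    simp only [(hlaw _).map_eq]

lemma indepFun_past_batch {k : ℕ} (hk : k < N) (hY : ∀ k < N, ∀ i, AEMeasurable (Y k i) P)
    (hindep : iIndepFun (fun ki : Fin N × Fin m => Y ki.1 ki.2) P) :
    IndepFun (fun ω (j : Set.Iio k) i => Y j i ω) (fun ω i => Y k i ω) P := by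
  let past : Finset (Fin N × Fin m) := {p | p.1 < ⟨k, hk⟩}
  let present : Finset (Fin N × Fin m) := {p | p.1 = ⟨k, hk⟩}
  have hdisj : Disjoint past present :=
    Finset.disjoint_filter.2 fun p _ hlt heq => hlt.ne heq
  have hfin := hindep.indepFun_finset₀ past present hdisj fun p => hY p.1 p.1.2 p.2
  let φ : (past → E) → Set.Iio k → Fin m → E := fun x j i =>
    x ⟨(⟨j, j.2.trans hk⟩, i), Finset.mem_filter.2 ⟨Finset.mem_univ _, j.2⟩⟩
  let ψ : (present → E) → Fin m → E := fun x i =>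
    x ⟨(⟨k, hk⟩, i), Finset.mem_filter.2 ⟨Finset.mem_univ _, rfl⟩⟩
  exact hfin.comp (φ := φ) (ψ := ψ) (by fun_prop) (by fun_prop)

lemma indepFun_batches {R : Ω → ℕ}
    (hR : IndepFun R (fun ω (ki : Fin N × Fin m) => Y ki.1 ki.2 ω) P) :
    IndepFun R (fun ω (k : Set.Iio N) i => Y k i ω) P :=
  let φ : (Fin N × Fin m → E) → Set.Iio N → Fin m → E := fun x k i => x (⟨k, k.2⟩, i)
  hR.comp (ψ := φ) measurable_id (by fun_prop)

end Batches

namespace ImportanceModel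

variable {E V Ω : Type*} [MeasurableSpace E] [Finite E] [MeasurableSingletonClass E]
  [NormedAddCommGroup V] [InnerProductSpace ℝ V] [CompleteSpace V] [MeasurableSpace Ω]

theorem integral_norm_gradValue_stochAscent_sq_le (Q : ImportanceModel E V) {g : ℝ → ℝ}
    {ℓ : Measure (Set E)} [IsFiniteMeasure ℓ] {C L : ℝ}
    (hg : HasLipschitzDerivOn g (Set.Icc 0 1) C L) {N m : ℕ} (hN : 0 < N) (hm : 0 < m) {α v : ℝ}
    (hα : 0 < α) (hv : ∀ θ, Q.value g ℓ θ ≤ v) (θ₀ : V) {P : Measure Ω} [IsProbabilityMeasure P]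
    {z : ℕ → Ω → Fin m → E} (hz : ∀ k < N, HasLaw (z k) (Measure.pi fun _ => Q.law) P)
    (hfresh : ∀ k < N, IndepFun (fun ω (j : Set.Iio k) => z j ω) (z k) P)
    {R : Ω → ℕ} (hR : HasLaw R (uniformOn (Set.Icc 1 N)) P)
    (hRz : IndepFun R (fun ω (k : Set.Iio N) => z k ω) P) :
    ∫ ω, ‖Q.gradValue g ℓ (stochAscent (Q.gradValueEst g ℓ) α θ₀ (fun k => z k ω) (R ω))‖ ^ 2 ∂P ≤
      2 * (v - Q.value g ℓ θ₀) / (N * α) +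
        ℓ.real Set.univ ^ 2 * Q.ratioBound ^ 2 * Q.scoreBound ^ 2 *
          (α * C ^ 2 * Q.gradLip ℓ C L + 2 * (C ^ 2 + L ^ 2) / m) := by
  set K := ℓ.real Set.univ ^ 2 * Q.ratioBound ^ 2 * Q.scoreBound ^ 2
  have hK : 0 ≤ K := by positivity
  have hbias : 0 ≤ α * C ^ 2 * Q.gradLip ℓ C L :=
    mul_nonneg (by positivity) (Q.gradLip_nonneg hg ℓ)
  have hvariance : 0 ≤ 2 * (C ^ 2 + L ^ 2) / (m : ℝ) := by positivity
  rw [mul_add]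
  rcases le_total (α * Q.gradLip ℓ C L) 1 with hsmall | hlarge
  · have hB : ∀ k < N, ∀ θ, ∫ y, ‖Q.gradValueEst g ℓ θ y - Q.gradValue g ℓ θ‖ ^ 2 ∂P.map (z k) ≤
        K * (2 * (C ^ 2 + L ^ 2) / m) := fun k hk θ => by
      rw [(hz k hk).map_eq]
      exact (Q.integral_norm_gradValueEst_sub_sq_le hg hm θ).trans_eq (by ring)
    refine (integral_norm_gradient_stochAscent_sq_le (Q.hasGradientAt_value hg)
      (Q.norm_gradValue_sub_le hg) hα hsmall hv _ θ₀ hN (fun k hk => (hz k hk).aemeasurable)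
      hfresh hB hR hRz).trans ?_
    linarith [mul_nonneg hK hbias]
  -- For a large step the a priori bound on the gradient is already smaller than the bias term.
  · have hgrad : ∀ θ, ‖Q.gradValue g ℓ θ‖ ^ 2 ≤ K * (α * C ^ 2 * Q.gradLip ℓ C L) := fun θ =>
      calc _ ≤ (C * Q.scoreBound * ℓ.real Set.univ) ^ 2 * 1 ^ 2 * 1 := by
            rw [one_pow, mul_one, mul_one]
            exact pow_le_pow_left₀ (norm_nonneg _) (Q.norm_gradValue_le hg θ) 2
        _ ≤ (C * Q.scoreBound * ℓ.real Set.univ) ^ 2 * Q.ratioBound ^ 2 *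
            (α * Q.gradLip ℓ C L) := by
            gcongr
            exact Q.one_le_ratioBound
        _ = _ := by ring
    have hgap : 0 ≤ 2 * (v - Q.value g ℓ θ₀) / (N * α) :=
      div_nonneg (by linarith [hv θ₀]) (by positivity)
    refine (integral_mono (integrable_comp_stochAscent_uniformOn
      (fun k hk => (hz k hk).aemeasurable) hR _ α θ₀ fun θ => ‖Q.gradValue g ℓ θ‖ ^ 2)
      (integrable_const _) fun ω => hgrad _).trans ?_
    rw [integral_const, probReal_univ, one_smul]
    linarith [mul_nonneg hK hvariance]

end ImportanceModel

/-! ### Off-policy gradient ascent -/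

namespace EpisodicMDP

variable {S A : Type*} {d : ℕ}

section Score

variable (M : EpisodicMDP S A) {π : EuclideanSpace ℝ (Fin d) → StochPolicy S A}

lemma retBound_pos : 0 < M.retBound :=
  div_pos M.rMax_pos (sub_pos.2 M.discount_lt_one)

lemma isRatio_nonneg (π b : StochPolicy S A) (τ : Trajectory S A) : 0 ≤ M.isRatio π b τ :=
  Finset.prod_nonneg fun _ _ => div_nonneg ENNReal.toReal_nonneg ENNReal.toReal_nonneg

lemma isRatio_eq_exp_sum_log_mul (π b : StochPolicy S A) (hpos : ∀ s a, 0 < (π s a).toReal)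
    (τ : Trajectory S A) :
    M.isRatio π b τ =
      Real.exp (∑ t ∈ Finset.range (M.len τ), Real.log (π (τ t).1 (τ t).2).toReal) *
        ∏ t ∈ Finset.range (M.len τ), ((b (τ t).1 (τ t).2).toReal)⁻¹ := by
  rw [Real.exp_sum, ← Finset.prod_mul_distrib, isRatio]
  refine Finset.prod_congr rfl fun t _ => ?_
  rw [Real.exp_log (hpos _ _), div_eq_mul_inv]

lemma hasGradientAt_isRatio (b : StochPolicy S A) (hpos : ∀ θ s a, 0 < (π θ s a).toReal)
    {θ : EuclideanSpace ℝ (Fin d)}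
    (hdiff : ∀ s a, DifferentiableAt ℝ (fun η => Real.log (π η s a).toReal) θ)
    (τ : Trajectory S A) :
    HasGradientAt (fun η => M.isRatio (π η) b τ) (M.isRatio (π θ) b τ • M.score π θ τ) θ := by
  have hexp := ((HasFDerivAt.fun_sum (u := Finset.range (M.len τ)) fun t _ =>
    (hdiff (τ t).1 (τ t).2).hasGradientAt.hasFDerivAt).exp).mul_const
    (∏ t ∈ Finset.range (M.len τ), ((b (τ t).1 (τ t).2).toReal)⁻¹)
  simp_rw [hasGradientAt_iff_hasFDerivAt, fun η => M.isRatio_eq_exp_sum_log_mul (π η) b (hpos η) τ]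
  refine hexp.congr_fderiv ?_
  rw [smul_smul, score, map_smul, map_sum, mul_comm]

lemma norm_score_le {C : ℝ} {θ : EuclideanSpace ℝ (Fin d)}
    (hC : ∀ s a, ‖gradient (fun η => Real.log (π η s a).toReal) θ‖ ≤ C) (τ : Trajectory S A) :
    ‖M.score π θ τ‖ ≤ M.len τ * C :=
  (norm_sum_le_of_le _ fun _ _ => hC _ _).trans_eq (by simp)

lemma differentiable_score
    (hdiff : ∀ s a, Differentiable ℝ (gradient (fun η => Real.log (π η s a).toReal)))
    (τ : Trajectory S A) : Differentiable ℝ fun θ => M.score π θ τ :=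
  Differentiable.fun_sum fun _ _ => hdiff _ _

lemma norm_fderiv_score_le {C : ℝ} {θ : EuclideanSpace ℝ (Fin d)}
    (hdiff : ∀ s a, DifferentiableAt ℝ (gradient (fun η => Real.log (π η s a).toReal)) θ)
    (hC : ∀ s a, ‖fderiv ℝ (gradient (fun η => Real.log (π η s a).toReal)) θ‖ ≤ C)
    (τ : Trajectory S A) : ‖fderiv ℝ (fun η => M.score π η τ) θ‖ ≤ M.len τ * C := by
  have hsum : fderiv ℝ (fun η => M.score π η τ) θ = ∑ t ∈ Finset.range (M.len τ),
      fderiv ℝ (gradient (fun η => Real.log (π η (τ t).1 (τ t).2).toReal)) θ :=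
    fderiv_fun_sum fun t _ => hdiff _ _
  rw [hsum]
  exact (norm_sum_le_of_le _ fun _ _ => hC _ _).trans_eq (by simp)

lemma len_freeze_le {n : ℕ} (e : Finset.Iic n → S × A) : M.len (freeze e) ≤ n := by
  by_cases h : M.Terminates (freeze e)
  · obtain ⟨t, ht⟩ := h
    refine (M.len_le_of_fst_eq (t := min t n) ?_).trans (min_le_right t n)
    simpa [freeze] using ht
  -- Without a terminal state the length is the junk value `sInf ∅ = 0`.
  · have hempty : {t | (freeze e t).1 = M.terminal} = ∅ :=
      Set.eq_empty_iff_forall_notMem.2 fun t ht => h ⟨t, ht⟩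
    simp [len, hempty]

end Score

/-- The Lebesgue measure of the levels in `[-M_r, M_r]`, carried to the events that the return of
an episode, observed up to time `n`, is at most the level. -/
def returnLevels (M : EpisodicMDP S A) (n : ℕ) : Measure (Set (Finset.Iic n → S × A)) :=
  sublevelMeasure (fun e => M.ret (freeze e)) (-M.retBound) M.retBound

instance (M : EpisodicMDP S A) (n : ℕ) : IsFiniteMeasure (M.returnLevels n) := by
  rw [returnLevels]; infer_instance

lemma returnLevels_real_univ (M : EpisodicMDP S A) (n : ℕ) :
    (M.returnLevels n).real Set.univ = 2 * M.retBound := by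
  rw [returnLevels, sublevelMeasure_real_univ _ (neg_le_self M.retBound_pos.le)]
  ring

variable [Finite S] [Finite A] [MeasurableSpace S] [MeasurableSingletonClass S]
  [MeasurableSpace A] [MeasurableSingletonClass A]

/-- The standing assumptions on a smoothly parametrised policy `π` and a behaviour policy `b`:
the log-policies have bounded first and second derivatives, `b` dominates `π`, and the episodes
generated by `b` have bounded length and bounded importance sampling ratios. -/
structure OffPolicyAssumptions (M : EpisodicMDP S A)
    (π : EuclideanSpace ℝ (Fin d) → StochPolicy S A) (b : StochPolicy S A)
    (Md Mh Me Ms : ℝ) : Prop where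
  pos : ∀ θ s a, 0 < (π θ s a).toReal
  differentiable_log : ∀ s a, Differentiable ℝ (fun θ => Real.log (π θ s a).toReal)
  norm_gradient_log_le : ∀ θ s a, ‖gradient (fun η => Real.log (π η s a).toReal) θ‖ ≤ Md
  differentiable_gradient_log : ∀ s a,
    Differentiable ℝ (gradient (fun η => Real.log (π η s a).toReal))
  norm_fderiv_gradient_log_le : ∀ θ s a,
    ‖fderiv ℝ (gradient (fun η => Real.log (π η s a).toReal)) θ‖ ≤ Mh
  absolutelyContinuous : ∀ θ s a, b s a = 0 → π θ s a = 0
  len_le : ∀ᵐ τ ∂(M.law b M.init), M.Terminates τ ∧ (M.len τ : ℝ) ≤ Me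
  isRatio_le : ∀ θ, ∀ᵐ τ ∂(M.law b M.init), M.isRatio (π θ) b τ ≤ Ms

namespace OffPolicyAssumptions

variable {M : EpisodicMDP S A} {π : EuclideanSpace ℝ (Fin d) → StochPolicy S A}
  {b : StochPolicy S A} {Md Mh Me Ms : ℝ}

lemma ae_terminatesBy (H : M.OffPolicyAssumptions π b Md Mh Me Ms) :
    ∀ᵐ τ ∂M.law b M.init, M.TerminatesBy ⌊Me⌋₊ τ := by
  filter_upwards [H.len_le] with τ hτ
  exact M.terminatesBy_iff.2 ⟨hτ.1, Nat.le_floor hτ.2⟩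

lemma len_freeze_mul_le (H : M.OffPolicyAssumptions π b Md Mh Me Ms) {C x : ℝ} (hx : 0 ≤ x)
    (hC : x ≤ C) (e : Finset.Iic ⌊Me⌋₊ → S × A) : M.len (freeze e) * C ≤ Me * C := by
  obtain ⟨τ, -, hτ⟩ := H.len_le.exists
  have hMe : 0 ≤ Me := (Nat.cast_nonneg _).trans hτ
  exact mul_le_mul_of_nonneg_right ((Nat.cast_le.2 (M.len_freeze_le e)).trans
    (Nat.floor_le hMe)) (hx.trans hC)

lemma ae_isRatio_freeze_le (H : M.OffPolicyAssumptions π b Md Mh Me Ms)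
    (θ : EuclideanSpace ℝ (Fin d)) :
    ∀ᵐ e ∂M.prefixLaw b M.init ⌊Me⌋₊, M.isRatio (π θ) b (freeze e) ≤ Ms := by
  refine (ae_prefixLaw_iff (p := fun τ => M.isRatio (π θ) b τ ≤ Ms)).2 ?_
  filter_upwards [H.isRatio_le θ, H.ae_terminatesBy] with τ hτ hterm
  exact (M.isRatio_frozen (π θ) b hterm).trans_le hτ

/-- The episodes generated by `b`, observed up to their maximal length. -/
def model (H : M.OffPolicyAssumptions π b Md Mh Me Ms) :
    ImportanceModel (Finset.Iic ⌊Me⌋₊ → S × A) (EuclideanSpace ℝ (Fin d)) where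
  law := M.prefixLaw b M.init ⌊Me⌋₊
  ratio θ e := M.isRatio (π θ) b (freeze e)
  ratio_nonneg θ e := M.isRatio_nonneg _ _ _
  integral_ratio θ := integral_prefixLaw_isRatio (H.absolutelyContinuous θ) H.ae_terminatesBy
  ratioBound := Ms
  ratio_le := H.ae_isRatio_freeze_le
  score θ e := M.score π θ (freeze e)
  hasGradientAt_ratio θ e :=
    M.hasGradientAt_isRatio b H.pos (fun s a => H.differentiable_log s a θ) _
  scoreBound := Me * Md
  norm_score_le θ e := (M.norm_score_le (H.norm_gradient_log_le θ) _).trans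
    (H.len_freeze_mul_le (norm_nonneg _) (H.norm_gradient_log_le θ M.init (e ⟨0, by simp⟩).2) e)
  differentiable_score e := M.differentiable_score H.differentiable_gradient_log _
  hessBound := Me * Mh
  norm_fderiv_score_le θ e := (M.norm_fderiv_score_le
    (fun s a => H.differentiable_gradient_log s a θ) (H.norm_fderiv_gradient_log_le θ) _).trans
    (H.len_freeze_mul_le (norm_nonneg _)
      (H.norm_fderiv_gradient_log_le θ M.init (e ⟨0, by simp⟩).2) e)

variable {g : ℝ → ℝ}

lemma retCDF_eq_prob (H : M.OffPolicyAssumptions π b Md Mh Me Ms)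
    (θ : EuclideanSpace ℝ (Fin d)) (x : ℝ) :
    M.retCDF (π θ) x = H.model.prob θ {e | M.ret (freeze e) ≤ x} :=
  retCDF_eq_setIntegral_isRatio (H.absolutelyContinuous θ) H.ae_terminatesBy x

lemma drm_eq_value_sub (H : M.OffPolicyAssumptions π b Md Mh Me Ms)
    (θ : EuclideanSpace ℝ (Fin d)) :
    M.drm g (π θ) = H.model.value g (M.returnLevels ⌊Me⌋₊) θ - M.retBound := by
  have hMr := M.retBound_pos.le
  let ret : (Finset.Iic ⌊Me⌋₊ → S × A) → ℝ := fun e => M.ret (freeze e)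
  let φ : Set (Finset.Iic ⌊Me⌋₊ → S × A) → ℝ := fun c => g (1 - H.model.prob θ c)
  have hneg := intervalIntegrable_comp_sublevel ret (neg_nonpos.2 hMr) φ
  have hpos := intervalIntegrable_comp_sublevel ret hMr φ
  have hvalue := intervalIntegral_comp_sublevel ret (neg_le_self hMr) φ
  rw [← intervalIntegral.integral_add_adjacent_intervals hneg hpos] at hvalue
  simp only [drm, H.retCDF_eq_prob]
  rw [intervalIntegral.integral_sub hneg intervalIntegrable_const,
    intervalIntegral.integral_const, ImportanceModel.value, returnLevels, ← hvalue, smul_eq_mul]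
  ring

lemma bddAbove_range_drm (H : M.OffPolicyAssumptions π b Md Mh Me Ms)
    (hg : BddAbove (g '' Set.Icc 0 1)) : BddAbove (Set.range fun θ => M.drm g (π θ)) := by
  obtain ⟨B, hB⟩ := H.model.bddAbove_range_value hg (M.returnLevels ⌊Me⌋₊)
  refine ⟨B - M.retBound, Set.forall_mem_range.2 fun θ => ?_⟩
  rw [H.drm_eq_value_sub]
  exact sub_le_sub_right (hB (Set.mem_range_self θ)) _

lemma hasGradientAt_drm (H : M.OffPolicyAssumptions π b Md Mh Me Ms) {C L : ℝ}
    (hg : HasLipschitzDerivOn g (Set.Icc 0 1) C L) (θ : EuclideanSpace ℝ (Fin d)) :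
    HasGradientAt (fun θ => M.drm g (π θ)) (H.model.gradValue g (M.returnLevels ⌊Me⌋₊) θ) θ := by
  simp_rw [H.drm_eq_value_sub]
  exact hasGradientAt_iff_hasFDerivAt.2
    ((H.model.hasGradientAt_value hg θ).hasFDerivAt.sub_const M.retBound)

lemma gradLip_eq_drmLipConst (H : M.OffPolicyAssumptions π b Md Mh Me Ms) (C L : ℝ) :
    H.model.gradLip (M.returnLevels ⌊Me⌋₊) C L = drmLipConst M.retBound Me Md Mh C L := by
  rw [ImportanceModel.gradLip, M.returnLevels_real_univ, drmLipConst]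
  simp only [model]
  ring

section Batch

variable {m : ℕ} {τ : Fin m → Trajectory S A}

lemma cdfEst_eq_probEst (H : M.OffPolicyAssumptions π b Md Mh Me Ms)
    (θ : EuclideanSpace ℝ (Fin d)) (hτ : ∀ i, M.TerminatesBy ⌊Me⌋₊ (τ i)) (x : ℝ) :
    M.cdfEst (π θ) b τ x = H.model.probEst θ
      (fun i => Preorder.frestrictLe (π := fun _ => S × A) ⌊Me⌋₊ (τ i))
      {e | M.ret (freeze e) ≤ x} := by
  rw [cdfEst, ImportanceModel.probEst]
  congr! 3 with i
  simp only [Set.indicator_apply, Set.mem_ofPred_eq, M.ret_frozen (hτ i), model,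
    M.isRatio_frozen _ _ (hτ i)]

lemma gradCdfEst_eq_gradProbEst (H : M.OffPolicyAssumptions π b Md Mh Me Ms)
    (θ : EuclideanSpace ℝ (Fin d)) (hτ : ∀ i, M.TerminatesBy ⌊Me⌋₊ (τ i)) (x : ℝ) :
    M.gradCdfEst π b θ τ x = H.model.gradProbEst θ
      (fun i => Preorder.frestrictLe (π := fun _ => S × A) ⌊Me⌋₊ (τ i))
      {e | M.ret (freeze e) ≤ x} := by
  rw [gradCdfEst, ImportanceModel.gradProbEst]
  congr! 2 with i
  simp only [Set.indicator_apply, Set.mem_ofPred_eq, M.ret_frozen (hτ i), model,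
    M.isRatio_frozen _ _ (hτ i), M.score_frozen _ _ (hτ i)]

lemma drmGradEst_eq_gradValueEst (H : M.OffPolicyAssumptions π b Md Mh Me Ms)
    (θ : EuclideanSpace ℝ (Fin d)) (hτ : ∀ i, M.TerminatesBy ⌊Me⌋₊ (τ i)) :
    M.drmGradEst g π b θ τ = H.model.gradValueEst g (M.returnLevels ⌊Me⌋₊) θ
      (fun i => Preorder.frestrictLe (π := fun _ => S × A) ⌊Me⌋₊ (τ i)) := by
  simp only [drmGradEst, H.cdfEst_eq_probEst θ hτ, H.gradCdfEst_eq_gradProbEst θ hτ]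
  rw [← intervalIntegral.integral_neg]
  exact intervalIntegral_comp_sublevel (fun e : Finset.Iic ⌊Me⌋₊ → S × A => M.ret (freeze e))
    (neg_le_self M.retBound_pos.le) fun c =>
      -(derivWithin g (Set.Icc 0 1) (1 - H.model.probEst θ _ c) • H.model.gradProbEst θ _ c)

end Batch

lemma offPolicyIter_eq_stochAscent (H : M.OffPolicyAssumptions π b Md Mh Me Ms) (α : ℝ)
    (θ₀ : EuclideanSpace ℝ (Fin d)) {m k : ℕ} {τ : ℕ → Fin m → Trajectory S A}
    (hτ : ∀ j < k, ∀ i, M.TerminatesBy ⌊Me⌋₊ (τ j i)) :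
    M.offPolicyIter g π b α θ₀ τ k =
      stochAscent (H.model.gradValueEst g (M.returnLevels ⌊Me⌋₊)) α θ₀
        (fun j i => Preorder.frestrictLe (π := fun _ => S × A) ⌊Me⌋₊ (τ j i)) k := by
  induction k with
  | zero => rfl
  | succ k ih =>
    rw [offPolicyIter, stochAscent, ih fun j hj => hτ j (hj.trans k.lt_succ_self),
      H.drmGradEst_eq_gradValueEst _ (hτ k k.lt_succ_self)]

section Sampling

variable {N m : ℕ} {Ω : Type*} [MeasurableSpace Ω] {P : Measure Ω}
  {X : ℕ → Fin m → Ω → Trajectory S A} {R : Ω → ℕ}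

lemma ae_offPolicyIter_eq_stochAscent (H : M.OffPolicyAssumptions π b Md Mh Me Ms)
    (hlaw : ∀ k < N, ∀ i, HasLaw (X k i) (M.law b M.init) P)
    (hR : HasLaw R (uniformOn (Set.Icc 1 N)) P) (α : ℝ) (θ₀ : EuclideanSpace ℝ (Fin d)) :
    ∀ᵐ ω ∂P, M.offPolicyIter g π b α θ₀ (fun k i => X k i ω) (R ω) =
      stochAscent (H.model.gradValueEst g (M.returnLevels ⌊Me⌋₊)) α θ₀
        (fun k i => Preorder.frestrictLe (π := fun _ => S × A) ⌊Me⌋₊ (X k i ω)) (R ω) := by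
  have hterm : ∀ᵐ ω ∂P, ∀ k < N, ∀ i, M.TerminatesBy ⌊Me⌋₊ (X k i ω) := by
    refine ae_all_iff.2 fun k => ae_all_iff.2 fun hk => ae_all_iff.2 fun i => ?_
    refine ae_of_ae_map (hlaw k hk i).aemeasurable ?_
    rw [(hlaw k hk i).map_eq]
    exact H.ae_terminatesBy
  rw [← Finset.coe_Icc] at hR
  filter_upwards [hterm, ae_mem_of_hasLaw_uniformOn hR] with ω hω hRω
  exact H.offPolicyIter_eq_stochAscent α θ₀ fun k hk =>
    hω k (hk.trans_le (Finset.mem_Icc.1 hRω).2)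

lemma integrable_norm_gradValue_stochAscent_sq [IsProbabilityMeasure P]
    (H : M.OffPolicyAssumptions π b Md Mh Me Ms)
    (hlaw : ∀ k < N, ∀ i, HasLaw (X k i) (M.law b M.init) P)
    (hR : HasLaw R (uniformOn (Set.Icc 1 N)) P) (α : ℝ) (θ₀ : EuclideanSpace ℝ (Fin d)) :
    Integrable (fun ω => ‖H.model.gradValue g (M.returnLevels ⌊Me⌋₊)
      (stochAscent (H.model.gradValueEst g (M.returnLevels ⌊Me⌋₊)) α θ₀
        (fun k i => Preorder.frestrictLe (π := fun _ => S × A) ⌊Me⌋₊ (X k i ω)) (R ω))‖ ^ 2) P :=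
  integrable_comp_stochAscent_uniformOn
    (fun k hk => aemeasurable_pi_lambda _ fun i =>
      (Preorder.measurable_frestrictLe _).comp_aemeasurable (hlaw k hk i).aemeasurable)
    hR _ α θ₀ fun θ => ‖H.model.gradValue g (M.returnLevels ⌊Me⌋₊) θ‖ ^ 2

theorem integral_norm_gradValue_stochAscent_sq_le [IsProbabilityMeasure P]
    (H : M.OffPolicyAssumptions π b Md Mh Me Ms) {C L : ℝ}
    (hg : HasLipschitzDerivOn g (Set.Icc 0 1) C L) (hN : 0 < N) (hm : 0 < m) {α : ℝ} (hα : 0 < α)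
    (θ₀ : EuclideanSpace ℝ (Fin d))
    (hlaw : ∀ k < N, ∀ i, HasLaw (X k i) (M.law b M.init) P)
    (hindep : iIndepFun (fun ki : Fin N × Fin m => X ki.1 ki.2) P)
    (hR : HasLaw R (uniformOn (Set.Icc 1 N)) P)
    (hRindep : IndepFun R (fun ω (ki : Fin N × Fin m) => X ki.1 ki.2 ω) P) :
    ∫ ω, ‖H.model.gradValue g (M.returnLevels ⌊Me⌋₊)
      (stochAscent (H.model.gradValueEst g (M.returnLevels ⌊Me⌋₊)) α θ₀
        (fun k i => Preorder.frestrictLe (π := fun _ => S × A) ⌊Me⌋₊ (X k i ω)) (R ω))‖ ^ 2 ∂P ≤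
      2 * ((⨆ θ, M.drm g (π θ)) - M.drm g (π θ₀)) / (N * α) +
        4 * M.retBound ^ 2 * Ms ^ 2 * Me ^ 2 * Md ^ 2 *
          (α * C ^ 2 * drmLipConst M.retBound Me Md Mh C L + 2 * (C ^ 2 + L ^ 2) / m) := by
  let Y : ℕ → Fin m → Ω → Finset.Iic ⌊Me⌋₊ → S × A := fun k i ω =>
    Preorder.frestrictLe (π := fun _ => S × A) ⌊Me⌋₊ (X k i ω)
  have hrestrict : Measurable (Preorder.frestrictLe (π := fun _ => S × A) ⌊Me⌋₊) :=
    Preorder.measurable_frestrictLe _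
  have hYlaw : ∀ k < N, ∀ i, HasLaw (Y k i) (M.prefixLaw b M.init ⌊Me⌋₊) P := fun k hk i =>
    HasLaw.fun_comp ⟨hrestrict.aemeasurable, rfl⟩ (hlaw k hk i)
  have hYindep : iIndepFun (fun ki : Fin N × Fin m => Y ki.1 ki.2) P :=
    hindep.comp (fun _ => Preorder.frestrictLe (π := fun _ => S × A) ⌊Me⌋₊) fun _ => hrestrict
  have hYR : IndepFun R (fun ω (ki : Fin N × Fin m) => Y ki.1 ki.2 ω) P :=
    hRindep.comp measurable_id (measurable_pi_lambda
      (fun (x : Fin N × Fin m → Trajectory S A) ki =>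
        Preorder.frestrictLe (π := fun _ => S × A) ⌊Me⌋₊ (x ki))
      fun ki => hrestrict.comp (measurable_pi_apply ki))
  have hvalue : ∀ θ, H.model.value g (M.returnLevels ⌊Me⌋₊) θ ≤
      (⨆ θ, M.drm g (π θ)) + M.retBound := fun θ => by
    rw [← sub_le_iff_le_add, ← H.drm_eq_value_sub]
    exact le_ciSup (H.bddAbove_range_drm (hg.bddAbove_image isCompact_Icc)) θ
  refine (H.model.integral_norm_gradValue_stochAscent_sq_le hg hN hm hα hvalue θ₀
    (fun k hk => hasLaw_batch hk (hYlaw k hk) hYindep)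
    (fun k hk => indepFun_past_batch hk (fun k hk i => (hYlaw k hk i).aemeasurable) hYindep)
    hR (indepFun_batches hYR)).trans_eq ?_
  rw [H.gradLip_eq_drmLipConst, M.returnLevels_real_univ, H.drm_eq_value_sub θ₀]
  simp only [model]
  ring

end Sampling

lemma two_mul_sq_add_sq_div_le (H : M.OffPolicyAssumptions π b Md Mh Me Ms) (C L : ℝ) (m : ℕ) :
    2 * (C ^ 2 + L ^ 2) / (m : ℝ) ≤ 8 * (Real.exp 1 ^ 2 * C ^ 2 + L ^ 2 * Ms ^ 2) / m := by
  have hexp := le_mul_of_one_le_left (sq_nonneg C)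
    (one_le_pow₀ (n := 2) (Real.one_le_exp zero_le_one))
  have hMs := le_mul_of_one_le_right (sq_nonneg L) (one_le_pow₀ (n := 2) H.model.one_le_ratioBound)
  replace hMs : L ^ 2 ≤ L ^ 2 * Ms ^ 2 := hMs
  refine div_le_div_of_nonneg_right ?_ m.cast_nonneg
  linarith [sq_nonneg C, sq_nonneg L]

end OffPolicyAssumptions

end EpisodicMDP

end

theorem mainTheorem2_general {S A : Type*} [Finite S] [Finite A]
    [MeasurableSpace S] [MeasurableSingletonClass S]
    [MeasurableSpace A] [MeasurableSingletonClass A]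
    (M : EpisodicMDP S A) {d : ℕ}
    (π : EuclideanSpace ℝ (Fin d) → StochPolicy S A) (b : StochPolicy S A)
    (g : ℝ → ℝ) (Md Mh Mg' Mg'' Me Ms : ℝ)
    (H : M.OffPolicyAssumptions π b Md Mh Me Ms)
    (hg : HasLipschitzDerivOn g (Set.Icc 0 1) Mg' Mg'')
    (N m : ℕ) (hN : 0 < N) (hm : 0 < m) (α : ℝ) (hα : 0 < α)
    (θ₀ : EuclideanSpace ℝ (Fin d))
    {Ω : Type*} [MeasurableSpace Ω] (P : Measure Ω) [IsProbabilityMeasure P]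
    (X : ℕ → Fin m → Ω → Trajectory S A)
    (hlaw : ∀ k < N, ∀ i, HasLaw (X k i) (M.law b M.init) P)
    (hindep : iIndepFun (fun (ki : Fin N × Fin m) => X ki.1 ki.2) P)
    (R : Ω → ℕ) (hR : HasLaw R (uniformOn (Set.Icc 1 N)) P)
    (hRindep : IndepFun R (fun ω (ki : Fin N × Fin m) => X ki.1 ki.2 ω) P) :
    Differentiable ℝ (fun θ => M.drm g (π θ)) ∧
    BddAbove (Set.range fun θ => M.drm g (π θ)) ∧
    Integrable (fun ω => ‖gradient (fun θ => M.drm g (π θ))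
      (M.offPolicyIter g π b α θ₀ (fun k i => X k i ω) (R ω))‖ ^ 2) P ∧
    ∫ ω, ‖gradient (fun θ => M.drm g (π θ))
      (M.offPolicyIter g π b α θ₀ (fun k i => X k i ω) (R ω))‖ ^ 2 ∂P ≤
      2 * ((⨆ θ, M.drm g (π θ)) - M.drm g (π θ₀)) / (N * α) +
      4 * M.retBound ^ 2 * Ms ^ 2 * Me ^ 2 * Md ^ 2 *
        (α * Mg' ^ 2 * drmLipConst M.retBound Me Md Mh Mg' Mg'' +
          2 * (Mg' ^ 2 + Mg'' ^ 2) / m) := by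
  have hgrad : gradient (fun θ => M.drm g (π θ)) =
      H.model.gradValue g (M.returnLevels ⌊Me⌋₊) :=
    funext fun θ => (H.hasGradientAt_drm hg θ).gradient
  have hnorm := Filter.EventuallyEq.fun_comp
    (H.ae_offPolicyIter_eq_stochAscent (g := g) hlaw hR α θ₀)
    fun η => ‖H.model.gradValue g (M.returnLevels ⌊Me⌋₊) η‖ ^ 2
  rw [hgrad]
  refine ⟨fun θ => (H.hasGradientAt_drm hg θ).differentiableAt,
    H.bddAbove_range_drm (hg.bddAbove_image isCompact_Icc), ?_, ?_⟩
  · exact (integrable_congr hnorm).2 (H.integrable_norm_gradValue_stochAscent_sq hlaw hR α θ₀)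
  · exact (integral_congr_ae hnorm).trans_le
      (H.integral_norm_gradValue_stochAscent_sq_le hg hN hm hα θ₀ hlaw hindep hR hRindep)

theorem mainTheorem2 {S A : Type*} [Finite S] [Finite A]
    [MeasurableSpace S] [MeasurableSingletonClass S]
    [MeasurableSpace A] [MeasurableSingletonClass A]
    (M : EpisodicMDP S A) {d : ℕ}
    (π : EuclideanSpace ℝ (Fin d) → StochPolicy S A) (b : StochPolicy S A)
    (g : ℝ → ℝ) (Md Mh Mg' Mg'' Me Ms : ℝ)
    -- the policies are proper
    (hproper : ∃ K : ℕ, 0 < K ∧ ∀ θ s,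
      (M.law (π θ) s).real {τ | (τ K).1 ≠ M.terminal} < 1)
    (hproper_b : ∃ K : ℕ, 0 < K ∧ ∀ s, (M.law b s).real {τ | (τ K).1 ≠ M.terminal} < 1)
    -- log-policies are well defined and twice differentiable, with bounded derivatives
    (hpos : ∀ θ s a, 0 < (π θ s a).toReal)
    (hdiff : ∀ s a, Differentiable ℝ (fun θ => Real.log (π θ s a).toReal))
    (hMd : ∀ θ s a, ‖gradient (fun η => Real.log (π η s a).toReal) θ‖ ≤ Md)
    (hdiff2 : ∀ s a, Differentiable ℝ (gradient (fun η => Real.log (π η s a).toReal)))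
    (hMh : ∀ θ s a,
      ‖fderiv ℝ (gradient (fun η => Real.log (π η s a).toReal)) θ‖ ≤ Mh)
    -- the distortion function, with bounded first and second derivatives on the open interval
    (hg : IsDistortion g)
    (hg1 : DifferentiableOn ℝ g (Set.Ioo 0 1))
    (hMg1 : ∀ t ∈ Set.Ioo (0 : ℝ) 1, |deriv g t| ≤ Mg')
    (hg2 : DifferentiableOn ℝ (deriv g) (Set.Ioo 0 1))
    (hMg2 : ∀ t ∈ Set.Ioo (0 : ℝ) 1, |deriv (deriv g) t| ≤ Mg'')
    -- absolute continuity of the target policies with respect to the behaviour policy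
    (habs : ∀ θ s a, b s a = 0 → π θ s a = 0)
    -- the bounds on the episode length and on the importance sampling ratio
    (hMe : ∀ᵐ τ ∂(M.law b M.init), M.Terminates τ ∧ (M.len τ : ℝ) ≤ Me)
    (hMs : ∀ θ, ∀ᵐ τ ∂(M.law b M.init), M.isRatio (π θ) b τ ≤ Ms)
    -- the algorithm: `N` iterations, batches of `m` independent episodes generated by `b`
    (N m : ℕ) (hN : 0 < N) (hm : 0 < m) (α : ℝ) (hα : 0 < α)
    (θ₀ : EuclideanSpace ℝ (Fin d))
    {Ω : Type*} [MeasurableSpace Ω] (P : Measure Ω) [IsProbabilityMeasure P]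
    (X : ℕ → Fin m → Ω → Trajectory S A)
    (hlaw : ∀ k < N, ∀ i, HasLaw (X k i) (M.law b M.init) P)
    (hindep : iIndepFun (fun (ki : Fin N × Fin m) => X ki.1 ki.2) P)
    (R : Ω → ℕ) (hR : HasLaw R (uniformOn (Set.Icc 1 N)) P)
    (hRindep : IndepFun R (fun ω (ki : Fin N × Fin m) => X ki.1 ki.2 ω) P) :
    Differentiable ℝ (fun θ => M.drm g (π θ)) ∧
    BddAbove (Set.range fun θ => M.drm g (π θ)) ∧
    Integrable (fun ω => ‖gradient (fun θ => M.drm g (π θ))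
      (M.offPolicyIter g π b α θ₀ (fun k i => X k i ω) (R ω))‖ ^ 2) P ∧
    ∫ ω, ‖gradient (fun θ => M.drm g (π θ))
      (M.offPolicyIter g π b α θ₀ (fun k i => X k i ω) (R ω))‖ ^ 2 ∂P ≤
      2 * ((⨆ θ, M.drm g (π θ)) - M.drm g (π θ₀)) / (N * α) +
      4 * M.retBound ^ 2 * Ms ^ 2 * Me ^ 2 * Md ^ 2 *
        (α * Mg' ^ 2 * drmLipConst M.retBound Me Md Mh Mg' Mg'' +
          8 * (Real.exp 1 ^ 2 * Mg' ^ 2 + Mg'' ^ 2 * Ms ^ 2) / m) := by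
  have H : M.OffPolicyAssumptions π b Md Mh Me Ms :=
    ⟨hpos, hdiff, hMd, hdiff2, hMh, habs, hMe, hMs⟩
  have hgC : HasLipschitzDerivOn g (Set.Icc 0 1) Mg' Mg'' :=
    hasLipschitzDerivOn_Icc zero_lt_one hg.continuousOn hg1 hMg1 hg2 hMg2
  obtain ⟨hdrm, hbdd, hintegrable, hle⟩ := mainTheorem2_general M π b g Md Mh Mg' Mg'' Me Ms H hgC
    N m hN hm α hα θ₀ P X hlaw hindep R hR hRindep
  refine ⟨hdrm, hbdd, hintegrable, hle.trans ?_⟩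
  gcongr _ + _ * (_ + ?_)
  exact H.two_mul_sq_add_sq_div_le Mg' Mg'' m
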